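/- Setting. There are buyers $N=\{1,\dots,n\}$, sellers $M=\{1,\dots,m\}$ and a set $E\subseteq N\times M$ of edges; $E_i$ and $E_j$ denote the sets of edges at buyer $i$ and at seller $j$. For each $j\in M$ let $f_j:2^{E_j}\to\mathbb R_+$ be monotone and submodular with $f_j(\emptyset)=0$, let $P_j=\{x\in\mathbb R_+^{E_j}: x(F)\le f_j(F)\ \forall F\subseteq E_j\}$, and let $P=\bigoplus_{j\in M} P_j\subseteq\mathbb R^E_+$. Buyer $i$ has a valuation $v_i>0$ per unit and a budget $B_i\ge 0$; seller $j$ has a valuation $\rho_j>0$ per unit. An allocation $\mathcal A=(w,p,r)$ consists of transactions $w\in\mathbb R^E_+$, payments $p\in\mathbb R^N_+$ and revenues $r\in\mathbb R^M_+$; it is feasible if $w\in P$ and $p_i\le B_i$ for all $i\in N$. Its liquid welfare at seller valuations $\rho$ is $$\mathrm{LW}_\rho(\mathcal A)=\sum_{i\in N}\min\bigl(v_i\,w(E_i),B_i\bigr)+\sum_{j\in M}\rho_j\bigl(f_j(E_j)-w(E_j)\bigr),$$ and $\mathrm{LW}^{\mathrm{OPT}}(\rho)$ is the supremum of $\mathrm{LW}_\rho$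 over the feasible allocations. Polyhedral Clinching Auction (PCA). The input is a market as above, buyers' bids $v$, sellers' bids $\rho$, budgets $B$ and a price increment $\varepsilon>0$. For each seller $j$ add a virtual buyer $n+j$, adjacent only to $j$, with bid $v_{n+j}=\rho_j$ and budget $\infty$, and extend $f_j$ by $f_j(F)=f_j(E_j)$ (with the original $E_j$) whenever $F$ contains the virtual edge; from now on $N$, $E$ and $P$ refer to the extended market, whose buyers are ordered $1,\dots,n$ and then the virtual buyers in the order of their sellers. Start with $w=0$, $p=0$, $r=0$, price clocks $c_i=0$, demands $d_i=\infty$, and $l$ the first buyer. The demand of buyer $i$ at clock $c_i$ is $0$ if $c_i\ge v_i$, it is $\infty$ if $c_i=0$, and it is $(B_i-p_i)/c_i$ otherwise. While some $d_i\ne0$, repeat the following. (1) For the buyers $i$ in order: with the current $w,d$ let $P_{w,d}=\{y\in\mathbb R_+^E: w+y\in P,\ y(E_k)\le d_k\ \forall k\in N\}$, and for $\xi\in\mathbb R_+^{E_i}$ let $P^i_{w,d}(\xi)$ be the set of vectors $(y(E_k))_{k\in N\setminus i}$ with $y\in P_{w,d}$ and $y|_{E_i}=\xi$. Buyer $i$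 clinches a vector $\xi_i$ that is maximal in the componentwise order in $\{\xi\in\mathbb R_+^{E_i}:P^i_{w,d}(\xi)=P^i_{w,d}(0)\}$: add $\xi_i$ to $w|_{E_i}$, add $c_i\,\xi_i(E_i)$ to $p_i$, add $c_i\,\xi_{ij}$ to $r_j$ for every $ij\in E_i$, and recompute $d_i$. (2) Add $\varepsilon$ to $c_l$, recompute $d_l$, and let $l$ be the cyclically next buyer. At the end output $w$ restricted to the original edges, $p$ restricted to the original buyers, and the revenues $r_j-p_{n+j}$. The choice of the maximal vectors $\xi_i$ is arbitrary; each choice gives an outcome of the PCA. Single-sample mechanism $\mathbb M(\rho,\rho^s)$. The input consists of truthful buyers' bids $v$, budgets $B$, sellers' bids $\rho$ and a sample $\rho^s_j>0$ for each seller $j$. Let $\tilde M=\{j\in M:\rho^s_j\ge\rho_j\}$. Run the PCA with increment $\varepsilon$ on the submarket with buyers $N$, sellers $\tilde M$ and the edges at $\tilde M$ (with the polymatroids $P_j$, $j\in\tilde M$), with buyers' bids $v$ and sellers' bids $(\rho^s_j)_{j\in\tilde M}$. Keep its transactions and payments, with no transactions for sellers outside $\tilde M$; each $j\in\tilde M$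 receives $\rho^s_j\,w(E_j)$, and the other sellers receive $0$. Theorem. Let $\rho^a,\rho^b\in\mathbb R^M_{>0}$ be any two realizations of the sellers' values, and let $\varepsilon>0$. Suppose that, for each of the two runs of the PCA inside $\mathbb M(\rho^a,\rho^b)$ and $\mathbb M(\rho^b,\rho^a)$, all bids of that run (the $v_i$, $i\in N$, together with the samples of the sellers in $\tilde M$) are integer multiples of $\varepsilon$ and $\varepsilon\,(v_{\max}-v_{\min})\le v_{\min}^2$, where $v_{\max}$ and $v_{\min}$ are the largest and the smallest of these bids. Then both mechanisms have an outcome, and for all choices made in the auctions, with $\mathrm{LW}^{\mathbb M}(\rho,\rho^s)$ denoting $\mathrm{LW}_\rho$ of the outcome of $\mathbb M(\rho,\rho^s)$, $$\mathrm{LW}^{\mathbb M}(\rho^a,\rho^b)+\mathrm{LW}^{\mathbb M}(\rho^b,\rho^a)\ \ge\ \tfrac14\bigl(\mathrm{LW}^{\mathrm{OPT}}(\rho^a)+\mathrm{LW}^{\mathrm{OPT}}(\rho^b)\bigr).$$ -/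

import Mathlib

open scoped ENNReal

noncomputable section

/-- A two-sided market with buyers `N` and sellers `M`: a bipartite graph with edge set `E`, and for
each seller `j` a monotone submodular function `f j` on the subsets of the set of edges at `j`
(the values of `f j` on other sets are irrelevant and never used). -/
structure Market (N M : Type) [DecidableEq N] [DecidableEq M] where
  E : Finset (N × M)
  f : M → Finset (N × M) → ℝ
  f_empty : ∀ j, f j ∅ = 0
  f_mono : ∀ j, ∀ S T : Finset (N × M), S ⊆ T → T ⊆ E.filter (fun e => e.2 = j) → f j S ≤ f j T
  f_submod : ∀ j, ∀ S T : Finset (N × M), S ⊆ E.filter (fun e => e.2 = j) →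
    T ⊆ E.filter (fun e => e.2 = j) → f j (S ∩ T) + f j (S ∪ T) ≤ f j S + f j T

/-- An allocation: transactions `w` (indexed by all pairs, relevant on the edges), payments `p` of
the buyers and revenues `r` of the sellers. -/
@[ext] structure Allocation (N M : Type) where
  w : N × M → ℝ
  p : N → ℝ
  r : M → ℝ

namespace Market

variable {N M : Type} [DecidableEq N] [DecidableEq M]

/-- The edges at buyer `i`. -/
def buyerEdges (G : Market N M) (i : N) : Finset (N × M) := G.E.filter (fun e => e.1 = i)

/-- The edges at seller `j`. -/
def sellerEdges (G : Market N M) (j : M) : Finset (N × M) := G.E.filter (fun e => e.2 = j)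

/-- The polymatroid `P = ⨁ⱼ Pⱼ ⊆ ℝ^E₊`. A vector indexed by the edges is a function on all pairs that
vanishes off `E`. -/
def polymatroid (G : Market N M) : Set (N × M → ℝ) :=
  {w | (∀ e, 0 ≤ w e) ∧ (∀ e, e ∉ G.E → w e = 0) ∧
    ∀ j, ∀ F : Finset (N × M), F ⊆ G.sellerEdges j → ∑ e ∈ F, w e ≤ G.f j F}

/-- The liquid welfare of an allocation, for buyer valuations `v`, budgets `B` and seller
valuations `ρ`: a seller values the goods that she keeps. -/
def liquidWelfare [Fintype N] [Fintype M] (G : Market N M) (v B : N → ℝ) (ρ : M → ℝ)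
    (A : Allocation N M) : ℝ :=
  ∑ i, min (v i * ∑ e ∈ G.buyerEdges i, A.w e) (B i) +
    ∑ j, ρ j * (G.f j (G.sellerEdges j) - ∑ e ∈ G.sellerEdges j, A.w e)

/-- Feasible allocations: polymatroid constraints and budget constraints. -/
def Feasible (G : Market N M) (B : N → ℝ) (A : Allocation N M) : Prop :=
  A.w ∈ G.polymatroid ∧ (∀ i, 0 ≤ A.p i ∧ A.p i ≤ B i) ∧ ∀ j, 0 ≤ A.r j

/-- The optimal liquid welfare. -/
def optLiquidWelfare [Fintype N] [Fintype M] (G : Market N M) (v B : N → ℝ) (ρ : M → ℝ) : ℝ :=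
  sSup {t | ∃ A : Allocation N M, G.Feasible B A ∧ t = G.liquidWelfare v B ρ A}

/-- The submarket with seller set `S`. -/
def restrict [Fintype N] (G : Market N M) (S : Finset M) : Market N {j // j ∈ S} where
  E := Finset.univ.filter (fun e => (e.1, (e.2 : M)) ∈ G.E)
  f := fun j F => G.f j (F.image (fun e => (e.1, (e.2 : M))))
  f_empty := by intro j; simpa using G.f_empty j
  f_mono := by
    intro j A T hAT hT
    refine G.f_mono j _ _ (Finset.image_subset_image hAT) ?_
    intro e he
    obtain ⟨e', he', rfl⟩ := Finset.mem_image.1 he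
    have := hT he'
    simp only [Finset.mem_filter, Finset.mem_univ, true_and] at this
    exact Finset.mem_filter.2 ⟨this.1, congrArg Subtype.val this.2⟩
  f_submod := by
    intro j A T hA hT
    have inj : Function.Injective (fun e : N × {j // j ∈ S} => (e.1, (e.2 : M))) := by
      rintro ⟨a, b⟩ ⟨c, d⟩ h
      simp only [Prod.mk.injEq] at h
      exact Prod.ext h.1 (Subtype.ext h.2)
    have key : ∀ T : Finset (N × {j // j ∈ S}),
        T ⊆ (Finset.univ.filter (fun e : N × {j // j ∈ S} => (e.1, (e.2 : M)) ∈ G.E)).filter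
          (fun e => e.2 = j) →
        T.image (fun e => (e.1, (e.2 : M))) ⊆ G.E.filter (fun e => e.2 = (j : M)) := by
      intro T hT e he
      obtain ⟨e', he', rfl⟩ := Finset.mem_image.1 he
      have := hT he'
      simp only [Finset.mem_filter, Finset.mem_univ, true_and] at this
      exact Finset.mem_filter.2 ⟨this.1, congrArg Subtype.val this.2⟩
    rw [Finset.image_inter _ _ inj, Finset.image_union]
    exact G.f_submod j _ _ (key A hA) (key T hT)

/-- The market extended by one virtual buyer `Sum.inr j` for each seller `j`, adjacent only to `j`;
a set of edges at `j` that contains the virtual one has the value of the whole supply of `j`. -/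
def withVirtual [Fintype M] (G : Market N M) : Market (N ⊕ M) M where
  E := G.E.image (fun e => (Sum.inl e.1, e.2)) ∪ Finset.univ.image (fun j => (Sum.inr j, j))
  f := fun j F =>
    if (Sum.inr j, j) ∈ F then G.f j (G.sellerEdges j)
    else G.f j ((G.sellerEdges j).filter (fun e => (Sum.inl e.1, e.2) ∈ F))
  f_empty := by intro j; simp [G.f_empty]
  f_mono := by
    intro j S T hST _
    have h1 : ∀ X : Finset (N × M), X ⊆ G.sellerEdges j →
        G.f j X ≤ G.f j (G.sellerEdges j) := fun X hX => G.f_mono j X _ hX (subset_refl _)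
    by_cases hT : ((Sum.inr j, j) : (N ⊕ M) × M) ∈ T
    · by_cases hS : ((Sum.inr j, j) : (N ⊕ M) × M) ∈ S
      · simp [hS, hT]
      · simpa [hS, hT] using h1 _ (Finset.filter_subset _ _)
    · have hS : ((Sum.inr j, j) : (N ⊕ M) × M) ∉ S := fun h => hT (hST h)
      simp only [hS, hT, if_false]
      refine G.f_mono j _ _ ?_ (Finset.filter_subset _ _)
      intro e he
      rw [Finset.mem_filter] at he ⊢
      exact ⟨he.1, hST he.2⟩
  f_submod := by
    intro j S T _ _
    have h1 : ∀ X : Finset (N × M), X ⊆ G.sellerEdges j →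
        G.f j X ≤ G.f j (G.sellerEdges j) := fun X hX => G.f_mono j X _ hX (subset_refl _)
    have h2 : ∀ X Y : Finset ((N ⊕ M) × M), X ⊆ Y →
        G.f j ((G.sellerEdges j).filter (fun e => (Sum.inl e.1, e.2) ∈ X)) ≤
        G.f j ((G.sellerEdges j).filter (fun e => (Sum.inl e.1, e.2) ∈ Y)) := by
      intro X Y hXY
      refine G.f_mono j _ _ ?_ (Finset.filter_subset _ _)
      intro e he
      rw [Finset.mem_filter] at he ⊢
      exact ⟨he.1, hXY he.2⟩
    by_cases hS : ((Sum.inr j, j) : (N ⊕ M) × M) ∈ S <;>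
      by_cases hT : ((Sum.inr j, j) : (N ⊕ M) × M) ∈ T
    · simp [hS, hT]
    · have := h2 _ _ (Finset.inter_subset_right (s₁ := S) (s₂ := T))
      simp only [Finset.mem_inter, Finset.mem_union, hS, hT, and_false, true_or, if_true,
        if_false] at this ⊢
      linarith
    · have := h2 _ _ (Finset.inter_subset_left (s₁ := S) (s₂ := T))
      simp only [Finset.mem_inter, Finset.mem_union, hS, hT, and_true, or_true, if_true,
        if_false] at this ⊢
      linarith
    · have := G.f_submod j ((G.sellerEdges j).filter (fun e => (Sum.inl e.1, e.2) ∈ S))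
        ((G.sellerEdges j).filter (fun e => (Sum.inl e.1, e.2) ∈ T))
        (Finset.filter_subset _ _) (Finset.filter_subset _ _)
      rw [← Finset.filter_and, ← Finset.filter_or] at this
      simpa [hS, hT] using this

/-- The remnant supply polytope `P_{w,d}`: what can still be transacted after `w`, given the
demands `d`. -/
def remnant (G : Market N M) (w : N × M → ℝ) (d : N → ℝ≥0∞) : Set (N × M → ℝ) :=
  {y | (∀ e, 0 ≤ y e) ∧ (∀ e, e ∉ G.E → y e = 0) ∧ w + y ∈ G.polymatroid ∧
    ∀ i, ENNReal.ofReal (∑ e ∈ G.buyerEdges i, y e) ≤ d i}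

/-- `Pⁱ_{w,d}(ξ)`: the possible future amounts of the buyers other than `i` when buyer `i` transacts
exactly `ξ`. -/
def othersPolytope (G : Market N M) (w : N × M → ℝ) (d : N → ℝ≥0∞) (i : N) (ξ : N × M → ℝ) :
    Set ({k : N // k ≠ i} → ℝ) :=
  {u | ∃ y ∈ G.remnant w d, (∀ e ∈ G.buyerEdges i, y e = ξ e) ∧
    ∀ k : {k : N // k ≠ i}, ∑ e ∈ G.buyerEdges k, y e = u k}

/-- The clinching polytope of buyer `i`: the vectors on the edges at `i` that do not affect the
possible future amounts of the other buyers. -/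
def clinchingPolytope (G : Market N M) (w : N × M → ℝ) (d : N → ℝ≥0∞) (i : N) :
    Set (N × M → ℝ) :=
  {ξ | (∀ e, 0 ≤ ξ e) ∧ (∀ e, e ∉ G.buyerEdges i → ξ e = 0) ∧
    G.othersPolytope w d i ξ = G.othersPolytope w d i 0}

end Market

/-- The current state of the auction: transactions `w`, payments `p`, revenues `r`, price clocks
`c`, demands `d`, and the position `l` (in the order of buyers) of the buyer whose clock moves
next. -/
@[ext] structure AuctionState (N M : Type) where
  w : N × M → ℝ
  p : N → ℝ
  r : M → ℝ
  c : N → ℝ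
  d : N → ℝ≥0∞
  l : ℕ

namespace Auction

/-- The demand at price clock `c` of a buyer with bid `b` and budget `B` who has paid `p`;
it is infinite while the clock is `0`. -/
def demand (b : ℝ) (B : ℝ≥0∞) (p c : ℝ) : ℝ≥0∞ :=
  if b ≤ c then 0 else if c = 0 then ⊤ else (B - ENNReal.ofReal p) / ENNReal.ofReal c

section core

variable {N M : Type} [DecidableEq N] [DecidableEq M]

/-- All quantities are `0`, all demands are infinite, and the first buyer is next. -/
def initial (N M : Type) : AuctionState N M :=
  { w := 0, p := 0, r := 0, c := 0, d := fun _ => ⊤, l := 0 }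

/-- Buyer `i` clinches some maximal vector of her clinching polytope, at the price `c i`. -/
def ClinchOne (G : Market N M) (b : N → ℝ) (B : N → ℝ≥0∞) (i : N) (s t : AuctionState N M) :
    Prop :=
  ∃ ξ, Maximal (fun ξ => ξ ∈ G.clinchingPolytope s.w s.d i) ξ ∧
    t = { s with
          w := s.w + ξ
          p := Function.update s.p i (s.p i + s.c i * ∑ e ∈ G.buyerEdges i, ξ e)
          r := fun j => s.r j + ∑ e ∈ G.sellerEdges j, s.c i * ξ e
          d := Function.update s.d i
            (demand (b i) (B i) (s.p i + s.c i * ∑ e ∈ G.buyerEdges i, ξ e) (s.c i)) }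

/-- The buyers in a list clinch one after the other. -/
def ClinchList (G : Market N M) (b : N → ℝ) (B : N → ℝ≥0∞) :
    List N → AuctionState N M → AuctionState N M → Prop
  | [], s, t => t = s
  | i :: is, s, t => ∃ u, ClinchOne G b B i s u ∧ ClinchList G b B is u t

/-- The clock of the buyer at position `l` of `order` is raised by `ε`, her demand is updated, and
`l` moves on cyclically. -/
def Tick (b : N → ℝ) (B : N → ℝ≥0∞) (ε : ℝ) (order : List N) (s t : AuctionState N M) : Prop :=
  ∃ k, order[s.l]? = some k ∧
    t = { s with
          c := Function.update s.c k (s.c k + ε)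
          d := Function.update s.d k (demand (b k) (B k) (s.p k) (s.c k + ε))
          l := (s.l + 1) % order.length }

/-- One iteration of the while loop. -/
def Iteration (G : Market N M) (b : N → ℝ) (B : N → ℝ≥0∞) (ε : ℝ) (order : List N)
    (s t : AuctionState N M) : Prop :=
  (∃ i, s.d i ≠ 0) ∧ ∃ u, ClinchList G b B order s u ∧ Tick b B ε order u t

end core

variable {N M : Type} [Fintype N] [LinearOrder N] [Fintype M] [LinearOrder M]

/-- The order of the buyers of the extended market: first the buyers in increasing order, then the
virtual buyers in increasing order of their sellers. -/
def order (N M : Type) [Fintype N] [LinearOrder N] [Fintype M] [LinearOrder M] : List (N ⊕ M) :=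
  ((Finset.univ : Finset N).sort (· ≤ ·)).map Sum.inl ++
    ((Finset.univ : Finset M).sort (· ≤ ·)).map Sum.inr

/-- `A` is an outcome of the Polyhedral Clinching Auction in the market `G` for buyers' bids `v`,
sellers' bids `ρ`, budgets `B` and price increment `ε`. Different outcomes correspond to different
choices of the maximal vectors that are clinched. Virtual buyers have the bids of their sellers and
infinite budgets. -/
def IsPCAOutcome (G : Market N M) (v : N → ℝ) (ρ : M → ℝ) (B : N → ℝ) (ε : ℝ)
    (A : Allocation N M) : Prop :=
  ∃ s : AuctionState (N ⊕ M) M,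
    Relation.ReflTransGen
      (Iteration G.withVirtual (Sum.elim v ρ) (Sum.elim (fun i => ENNReal.ofReal (B i)) fun _ => ⊤)
        ε (order N M))
      (initial (N ⊕ M) M) s ∧
    (∀ k, s.d k = 0) ∧
    A = { w := fun e => s.w (Sum.inl e.1, e.2)
          p := fun i => s.p (Sum.inl i)
          r := fun j => s.r j - s.p (Sum.inr j) }

/-- The sellers whose sample is at least their bid. -/
def participants (ρ ρs : M → ℝ) : Finset M := Finset.univ.filter (fun j => ρ j ≤ ρs j)

/-- The samples of the participating sellers. -/
def participantSamples (ρ ρs : M → ℝ) : {j // j ∈ participants ρ ρs} → ℝ := fun j => ρs j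

/-- `A` is an outcome of the single-sample mechanism for buyers' bids `v`, sellers' bids `ρ`,
samples `ρs` and budgets `B`: run the Polyhedral Clinching Auction on the submarket of the
participating sellers, with their samples as bids; each of them is paid her sample per unit. -/
def IsSingleSampleOutcome (G : Market N M) (v : N → ℝ) (ρ ρs : M → ℝ) (B : N → ℝ) (ε : ℝ)
    (A : Allocation N M) : Prop :=
  ∃ A' : Allocation N {j // j ∈ participants ρ ρs},
    IsPCAOutcome (G.restrict (participants ρ ρs)) v (participantSamples ρ ρs) B ε A' ∧
    A = { w := fun e => if h : e.2 ∈ participants ρ ρs then A'.w (e.1, ⟨e.2, h⟩) else 0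
          p := A'.p
          r := fun j => if h : j ∈ participants ρ ρs then
              ρs j * ∑ e ∈ (G.restrict (participants ρ ρs)).sellerEdges ⟨j, h⟩, A'.w e
            else 0 }

/-- The price increment `ε` fits the positive bids `b`: every bid is a multiple of `ε`, and
`ε * (max b - min b) ≤ (min b) ^ 2`. -/
def FitsBids {K : Type} (ε : ℝ) (b : K → ℝ) : Prop :=
  (∀ k, ∃ z : ℕ, b k = z * ε) ∧ ∀ k l, ε * (b k - b l) ≤ b l ^ 2

end Auction

end

/-! One factor 2 is lost in the auction and another, on average over the two runs, in the sampling.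

Auction: measured at its own bids, the PCA reaches half of the optimal liquid welfare
(`IsPCAOutcome.half_optimal`). Let `μ` be the smallest bid and `κ = 1 + ε / μ`. Scale the competing
transactions down until every buyer can afford them at her bid, hand the goods they leave unsold to
the virtual buyers, and follow the auction with a vector `y` of transactions that are still
possible. In `potential`, a buyer counts with her value `b (y + w)`, a buyer of a set `S` with `κ (p
+ μ y)`, and each unit of sellable supply that `y` leaves idle counts with a price `q`, one step
ahead of the lowest clocks. A suitable `y` keeps the potential from falling. In a clinch, `y` need
only change at the clinching buyer (`Market.exists_remnant_after_clinch`), and units clinched beyond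
`y` are worth at least `q`. In a tick, maximal clinching has made sure that the other buyers can
absorb all the sellable supply (`Market.exists_maximum_without`), so none is lost; a buyer who drops
out turns her part of `y` into idle supply, priced no lower than her bid. At the end only `κ p` on
`S` and `b w` off `S` remain. For `S` the buyers who have bought and whose value reaches the budget,
`exhausted_bound` charges the missing part of the optimum and `κ p` to twice the budgets; this is
where `ε (v_max - v_min) ≤ v_min ^ 2` enters. Buyers of `S` bid more than `μ`, because a virtual
buyer has infinite demand until her clock reaches her bid, so original buyers clinch nothing at
prices below `μ`.

The steps about future transactions rest on polymatroids: contraction by `w`, merging all edges of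
each other buyer (undone by `IsPolymatroidRank.exists_split`), augmentation and uncrossing of tight
sets.

Sampling: the participants of the two runs cover all sellers, and each takes part with the larger of
her two values as bid. Budget truncation is subadditive, so either optimum is at most the sum of the
two submarket optima. Whatever a run overstates by the sample is recovered in the other run, where
this seller stays out and keeps everything. Hence either optimum is at most twice the sum of the two
welfares. -/

noncomputable section

/-! ### Polymatroids: maximal vectors and tight sets -/

/-- A normalized, monotone and submodular set function. -/
structure IsPolymatroidRank {V : Type*} [DecidableEq V] (f : Finset V → ℝ) : Prop where
  empty : f ∅ = 0
  mono : ∀ A B, A ⊆ B → f A ≤ f B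
  submod : ∀ A B, f (A ∩ B) + f (A ∪ B) ≤ f A + f B

/-- The independent vectors of a set function. -/
def indepVectors {V : Type*} (f : Finset V → ℝ) : Set (V → ℝ) :=
  {x | (∀ e, 0 ≤ x e) ∧ ∀ F : Finset V, ∑ e ∈ F, x e ≤ f F}

namespace IsPolymatroidRank

variable {V V' : Type*} [DecidableEq V] [DecidableEq V'] {f : Finset V → ℝ}

lemma sum_add_single (z : V → ℝ) (e : V) (t : ℝ) (A : Finset V) :
    ∑ a ∈ A, (z + Pi.single e t : V → ℝ) a = ∑ a ∈ A, z a + if e ∈ A then t else 0 := by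
  simp [Finset.sum_add_distrib]

/-- The entry at `e` grows until it meets `b` or uses up the smallest slack among the sets
containing `e`, one of which then becomes tight. -/
lemma exists_raise_one [Fintype V] {z : V → ℝ} (hz : z ∈ indepVectors f)
    (e : V) (b : ℝ) (hb : z e ≤ b) :
    ∃ t, 0 ≤ t ∧ z + Pi.single e t ∈ indepVectors f ∧ z e + t ≤ b ∧
      (z e + t = b ∨ ∃ A : Finset V, e ∈ A ∧ ∑ a ∈ A, (z + Pi.single e t : V → ℝ) a = f A) := by
  obtain ⟨A, hA, hmin⟩ := Finset.exists_min_image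
    ((Finset.univ : Finset (Finset V)).filter (fun A => e ∈ A))
    (fun A => f A - ∑ a ∈ A, z a) ⟨{e}, by simp⟩
  simp only [Finset.mem_filter, Finset.mem_univ, true_and] at hA hmin
  have h0 : 0 ≤ f A - ∑ a ∈ A, z a := sub_nonneg.2 (hz.2 A)
  refine ⟨min (b - z e) (f A - ∑ a ∈ A, z a), le_min (by linarith) h0, ⟨?_, ?_⟩, ?_, ?_⟩
  · intro a
    have : 0 ≤ (Pi.single e (min (b - z e) (f A - ∑ a ∈ A, z a)) : V → ℝ) a := by
      by_cases h : a = e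
      · subst h; simpa using ⟨hb, hz.2 A⟩
      · simp [h]
    exact add_nonneg (hz.1 a) this
  · intro F
    rw [sum_add_single]
    split_ifs with h
    · linarith [hmin F h, min_le_right (b - z e) (f A - ∑ a ∈ A, z a)]
    · linarith [hz.2 F]
  · linarith [min_le_left (b - z e) (f A - ∑ a ∈ A, z a)]
  · rcases min_choice (b - z e) (f A - ∑ a ∈ A, z a) with h | h
    · left; rw [h]; ring
    · right
      refine ⟨A, hA, ?_⟩
      rw [sum_add_single, if_pos hA, h]; ring

lemma exists_raise [Fintype V] {x b : V → ℝ} (hx : x ∈ indepVectors f) (hb : x ≤ b) :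
    ∃ z ∈ indepVectors f, x ≤ z ∧ z ≤ b ∧
      ∀ e, z e = b e ∨ ∃ A : Finset V, e ∈ A ∧ ∑ a ∈ A, z a = f A := by
  suffices H : ∀ s : Finset V, ∃ z ∈ indepVectors f, x ≤ z ∧ z ≤ b ∧
      ∀ e ∈ s, z e = b e ∨ ∃ A : Finset V, e ∈ A ∧ ∑ a ∈ A, z a = f A by
    obtain ⟨z, h1, h2, h3, h4⟩ := H Finset.univ
    exact ⟨z, h1, h2, h3, fun e => h4 e (Finset.mem_univ e)⟩
  intro s
  induction s using Finset.induction_on with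
  | empty => exact ⟨x, hx, le_refl x, hb, by simp⟩
  | insert e s hes ih =>
    obtain ⟨z, hz, hxz, hzb, hs⟩ := ih
    obtain ⟨t, ht, hzt, hle, hor⟩ := exists_raise_one hz e (b e) (hzb e)
    have hmono : z ≤ z + Pi.single e t := by
      intro a
      by_cases h : a = e
      · subst h; simpa using ht
      · simp [h]
    refine ⟨_, hzt, hxz.trans hmono, ?_, ?_⟩
    · intro a
      by_cases h : a = e
      · subst h; simpa using hle
      · simpa [h] using hzb a
    · intro a ha
      rcases Finset.mem_insert.1 ha with rfl | ha
      · simpa using hor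
      · have hae : a ≠ e := fun h => hes (h ▸ ha)
        rcases hs a ha with h | ⟨A, haA, hA⟩
        · left; simpa [hae] using h
        -- A tight set stays tight, since its sum only grows and is still bounded by `f`.
        · exact Or.inr ⟨A, haA, le_antisymm (hzt.2 A)
            (hA ▸ Finset.sum_le_sum fun c _ => hmono c)⟩

/-- Uncrossing: submodularity leaves no slack to the union or the intersection. -/
lemma tight_union (hf : IsPolymatroidRank f) {z : V → ℝ} (hz : z ∈ indepVectors f)
    {A B : Finset V} (hA : ∑ a ∈ A, z a = f A) (hB : ∑ a ∈ B, z a = f B) :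
    ∑ a ∈ A ∪ B, z a = f (A ∪ B) := by
  have h1 := Finset.sum_union_inter (s₁ := A) (s₂ := B) (f := z)
  linarith [hz.2 (A ∪ B), hz.2 (A ∩ B), hf.submod A B]

lemma exists_largest_tight [Fintype V] (hf : IsPolymatroidRank f) {z : V → ℝ}
    (hz : z ∈ indepVectors f) :
    ∃ T : Finset V, ∑ a ∈ T, z a = f T ∧ ∀ A : Finset V, ∑ a ∈ A, z a = f A → A ⊆ T := by
  refine ⟨((Finset.univ : Finset (Finset V)).filter (fun A => ∑ a ∈ A, z a = f A)).sup id,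
    ?_, ?_⟩
  · refine Finset.sup_induction (p := fun A => ∑ a ∈ A, z a = f A) ?_ ?_ ?_
    · simpa using hf.empty.symm
    · intro A hA B hB
      exact hf.tight_union hz hA hB
    · intro A hA
      simpa using hA
  · intro A hA
    exact Finset.le_sup (f := id) (by simpa using hA)

/-- A vector that is maximal between `x` and `b`, and its largest tight set. -/
lemma exists_maximal_tight [Fintype V] (hf : IsPolymatroidRank f) {x b : V → ℝ}
    (hx : x ∈ indepVectors f) (hb : x ≤ b) :
    ∃ z ∈ indepVectors f, x ≤ z ∧ z ≤ b ∧ ∃ T : Finset V, ∑ a ∈ T, z a = f T ∧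
      (∀ A : Finset V, ∑ a ∈ A, z a = f A → A ⊆ T) ∧ ∀ e, e ∉ T → z e = b e := by
  obtain ⟨z, hz, hxz, hzb, h⟩ := exists_raise hx hb
  obtain ⟨T, hT, hmax⟩ := hf.exists_largest_tight hz
  refine ⟨z, hz, hxz, hzb, T, hT, hmax, fun e he => ?_⟩
  rcases h e with h | ⟨A, heA, hA⟩
  · exact h
  · exact absurd (hmax A hA heA) he

/-- Raise `x` to a maximal vector below `x ⊔ y`. On its largest tight set it attains the rank, which
bounds `y`; elsewhere it attains the cap, which dominates `y`. -/
lemma exists_augment [Fintype V] (hf : IsPolymatroidRank f) {x y : V → ℝ}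
    (hx : x ∈ indepVectors f) (hy : y ∈ indepVectors f) :
    ∃ z ∈ indepVectors f, x ≤ z ∧ z ≤ x ⊔ y ∧ ∑ e, y e ≤ ∑ e, z e := by
  obtain ⟨z, hz, hxz, hzb, T, hT, -, hoff⟩ := hf.exists_maximal_tight hx (le_sup_left : x ≤ x ⊔ y)
  refine ⟨z, hz, hxz, hzb, ?_⟩
  rw [← Finset.sum_add_sum_compl T y, ← Finset.sum_add_sum_compl T z]
  refine add_le_add (hT ▸ hy.2 T) (Finset.sum_le_sum fun e he => ?_)
  rw [hoff e (Finset.mem_compl.1 he)]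
  exact le_sup_right (a := x e)

end IsPolymatroidRank

/-! ### Contraction and aggregation of polymatroids -/

/-- The rank function of the vectors that can be added to `w`. -/
def contractRank {V : Type*} [Fintype V] [DecidableEq V] (f : Finset V → ℝ) (w : V → ℝ)
    (A : Finset V) : ℝ :=
  (Finset.univ : Finset (Finset V)).inf' Finset.univ_nonempty
    (fun C => f (A ∪ C) - ∑ e ∈ A ∪ C, w e)

namespace IsPolymatroidRank

variable {V V' : Type*} [Fintype V] [DecidableEq V'] {f : Finset V → ℝ}
  {w : V → ℝ}

lemma aggregate_mem (π : V → V') {x : V → ℝ} (hx : x ∈ indepVectors f) :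
    (fun v => ∑ e ∈ Finset.univ.filter (fun e => π e = v), x e) ∈
      indepVectors (fun A : Finset V' => f (Finset.univ.filter (fun e => π e ∈ A))) := by
  refine ⟨fun v => Finset.sum_nonneg fun e _ => hx.1 e, fun F => ?_⟩
  refine le_trans (le_of_eq ?_) (hx.2 _)
  rw [← Finset.sum_fiberwise_of_maps_to (s := Finset.univ.filter (fun e => π e ∈ F)) (t := F)
    (g := π) (by simp)]
  refine Finset.sum_congr rfl fun v hv => Finset.sum_congr ?_ fun _ _ => rfl
  ext e
  simp only [Finset.mem_filter, Finset.mem_univ, true_and]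
  constructor
  · rintro rfl; exact ⟨hv, rfl⟩
  · exact fun h => h.2

variable [DecidableEq V]

lemma contractRank_le {A C : Finset V} (h : A ⊆ C) :
    contractRank f w A ≤ f C - ∑ e ∈ C, w e := by
  have := Finset.inf'_le (fun C => f (A ∪ C) - ∑ e ∈ A ∪ C, w e) (Finset.mem_univ C)
  rwa [Finset.union_eq_right.2 h] at this

lemma exists_contractRank_eq (A : Finset V) :
    ∃ C, A ⊆ C ∧ contractRank f w A = f C - ∑ e ∈ C, w e := by
  obtain ⟨C, -, hC⟩ := Finset.exists_mem_eq_inf' (Finset.univ_nonempty (α := Finset V))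
    (fun C => f (A ∪ C) - ∑ e ∈ A ∪ C, w e)
  exact ⟨A ∪ C, Finset.subset_union_left, hC⟩

/-- The difference of `f` and the sum of `w` is submodular but need not be monotone; the minimum
over supersets repairs this. Submodularity survives by uncrossing the two minimizing supersets. -/
lemma contract (hf : IsPolymatroidRank f) (hw : w ∈ indepVectors f) :
    IsPolymatroidRank (contractRank f w) where
  empty := by
    apply le_antisymm
    · simpa [hf.empty] using contractRank_le (f := f) (w := w) (subset_refl ∅)
    · obtain ⟨C, -, hC⟩ := exists_contractRank_eq (f := f) (w := w) ∅
      rw [hC]; linarith [hw.2 C]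
  mono := by
    intro A B hAB
    obtain ⟨C, hBC, hC⟩ := exists_contractRank_eq (f := f) (w := w) B
    rw [hC]
    exact contractRank_le (hAB.trans hBC)
  submod := by
    intro A B
    obtain ⟨C, hAC, hC⟩ := exists_contractRank_eq (f := f) (w := w) A
    obtain ⟨D, hBD, hD⟩ := exists_contractRank_eq (f := f) (w := w) B
    have h1 := contractRank_le (f := f) (w := w) (Finset.inter_subset_inter hAC hBD)
    have h2 := contractRank_le (f := f) (w := w) (Finset.union_subset_union hAC hBD)
    have h3 := Finset.sum_union_inter (s₁ := C) (s₂ := D) (f := w)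
    rw [hC, hD]
    linarith [hf.submod C D]

/-- The minimum over supersets costs nothing: as `y ≥ 0`, a bound for `y` on a superset is also one
on the set. -/
lemma mem_contract_iff (hw : ∀ e, 0 ≤ w e) {y : V → ℝ} (hy : ∀ e, 0 ≤ y e) :
    y ∈ indepVectors (contractRank f w) ↔ w + y ∈ indepVectors f := by
  constructor
  · rintro ⟨-, h⟩
    refine ⟨fun e => add_nonneg (hw e) (hy e), fun F => ?_⟩
    simp only [Pi.add_apply, Finset.sum_add_distrib]
    linarith [h F, contractRank_le (f := f) (w := w) (subset_refl F)]
  · rintro ⟨-, h⟩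
    refine ⟨hy, fun F => ?_⟩
    obtain ⟨C, hFC, hC⟩ := exists_contractRank_eq (f := f) (w := w) F
    have := h C
    simp only [Pi.add_apply, Finset.sum_add_distrib] at this
    rw [hC]
    linarith [Finset.sum_le_sum_of_subset_of_nonneg (f := y) hFC fun e _ _ => hy e]

lemma aggregate (hf : IsPolymatroidRank f) (π : V → V') :
    IsPolymatroidRank (fun A : Finset V' => f (Finset.univ.filter (fun e => π e ∈ A))) where
  empty := by simp [hf.empty]
  mono := by
    intro A B hAB
    refine hf.mono _ _ fun e he => ?_
    simp only [Finset.mem_filter, Finset.mem_univ, true_and] at he ⊢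
    exact hAB he
  submod := by
    intro A B
    have := hf.submod (Finset.univ.filter (fun e => π e ∈ A)) (Finset.univ.filter (fun e => π e ∈ B))
    rw [← Finset.filter_and, ← Finset.filter_or] at this
    simpa using this

/-- Every independent vector of the aggregated rank function splits into an independent vector. -/
lemma exists_split [Fintype V'] (hf : IsPolymatroidRank f) (π : V → V') {u : V' → ℝ}
    (hu : u ∈ indepVectors (fun A : Finset V' => f (Finset.univ.filter (fun e => π e ∈ A)))) :
    ∃ x ∈ indepVectors f, ∀ v, ∑ e ∈ Finset.univ.filter (fun e => π e = v), x e = u v := by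
  -- The amounts `u` are handed out one element at a time: `x` is what the elements of `T` have
  -- received, `r v` what the other elements of the class `v` must still receive. The inequality is
  -- independence of the mixed vector with entries `x` on `T` and `r` on the rest of the classes.
  suffices H : ∀ T : Finset V, ∃ (x : V → ℝ) (r : V' → ℝ), (∀ e, 0 ≤ x e) ∧ (∀ v, 0 ≤ r v) ∧
      (∀ v, ∑ e ∈ T.filter (fun e => π e = v), x e + r v = u v) ∧
      ∀ A ⊆ T, ∀ C : Finset V', ∑ e ∈ A, x e + ∑ v ∈ C, r v ≤
        f (A ∪ Finset.univ.filter (fun e => π e ∈ C ∧ e ∉ T)) by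
    obtain ⟨x, r, hx, hr, hsum, hle⟩ := H Finset.univ
    refine ⟨x, ⟨hx, fun F => ?_⟩, fun v => ?_⟩
    · simpa using hle F (Finset.subset_univ F) ∅
    · have h1 := hle ∅ (Finset.empty_subset _) {v}
      simp only [Finset.sum_empty, Finset.sum_singleton, zero_add, Finset.mem_univ, not_true,
        and_false, Finset.filter_false, Finset.union_empty, hf.empty] at h1
      linarith [hsum v, hr v]
  intro T
  induction T using Finset.induction_on with
  | empty =>
    refine ⟨0, u, by simp, hu.1, by simp, ?_⟩
    intro A hA C
    rw [Finset.subset_empty.1 hA]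
    simpa using hu.2 C
  | insert b T hb ih =>
    obtain ⟨x, r, hx, hr, hsum, hle⟩ := ih
    set S : Finset V' → Finset V := fun C => Finset.univ.filter (fun e => π e ∈ C ∧ e ∉ T) with hS
    -- The element `b` receives as much as possible. Only constraints that contain `b` but not its
    -- class can stop it; if both are present, the transfer cancels.
    obtain ⟨⟨A₁, C₁⟩, hm, hmin⟩ := Finset.exists_min_image
      (T.powerset ×ˢ (Finset.univ : Finset (Finset V')).filter (fun C => π b ∉ C))
      (fun q => f (insert b (q.1 ∪ S q.2)) - ∑ e ∈ q.1, x e - ∑ v ∈ q.2, r v)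
      ⟨(∅, ∅), by simp⟩
    simp only [Finset.mem_product, Finset.mem_powerset, Finset.mem_filter, Finset.mem_univ,
      true_and] at hm hmin
    obtain ⟨hA₁, hC₁⟩ := hm
    set α := f (insert b (A₁ ∪ S C₁)) - ∑ e ∈ A₁, x e - ∑ v ∈ C₁, r v with hα
    have hα0 : 0 ≤ α := by
      have := hle A₁ hA₁ C₁
      have := hf.mono (A₁ ∪ S C₁) (insert b (A₁ ∪ S C₁)) (Finset.subset_insert _ _)
      linarith
    set t := min α (r (π b)) with ht
    have ht0 : 0 ≤ t := le_min hα0 (hr _)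
    have hxb : ∀ A ⊆ T, ∑ e ∈ A, Function.update x b t e = ∑ e ∈ A, x e := by
      intro A hA
      refine Finset.sum_congr rfl fun e he => ?_
      rw [Function.update_of_ne]
      rintro rfl
      exact hb (hA he)
    have hrsum : ∀ C : Finset V', ∑ v ∈ C, Function.update r (π b) (r (π b) - t) v =
        ∑ v ∈ C, r v - if π b ∈ C then t else 0 := by
      intro C
      split_ifs with h
      · rw [Finset.sum_update_of_mem h, ← Finset.add_sum_erase C r h, Finset.sdiff_singleton_eq_erase]
        ring
      · rw [Finset.sum_update_of_notMem h]; ring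
    refine ⟨Function.update x b t, Function.update r (π b) (r (π b) - t), ?_, ?_, ?_, ?_⟩
    · intro e
      by_cases h : e = b
      · subst h; simpa using ht0
      · simpa [h] using hx e
    · intro v
      by_cases h : v = π b
      · subst h; simp [ht]
      · simpa [h] using hr v
    · intro v
      rw [Finset.filter_insert]
      by_cases h : π b = v
      · rw [if_pos h, Finset.sum_insert (by simp [hb]), hxb _ (Finset.filter_subset _ _), ← hsum v]
        subst h
        simp only [Function.update_self]; ring
      · rw [if_neg h, hxb _ (Finset.filter_subset _ _), Function.update_of_ne (Ne.symm h), hsum v]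
    · intro A hA C
      have hS' : Finset.univ.filter (fun e => π e ∈ C ∧ e ∉ insert b T) = (S C).erase b := by
        ext e
        simp only [hS, Finset.mem_filter, Finset.mem_univ, true_and, Finset.mem_erase,
          Finset.mem_insert, not_or]
        tauto
      rw [hS', hrsum]
      by_cases hbA : b ∈ A
      · have hA0 : A.erase b ⊆ T := by
          intro e he
          rw [Finset.mem_erase] at he
          exact (Finset.mem_insert.1 (hA he.2)).resolve_left he.1
        have hset : A ∪ (S C).erase b = insert b (A.erase b ∪ S C) := by
          ext e
          simp only [Finset.mem_union, Finset.mem_erase, Finset.mem_insert]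
          by_cases h : e = b
          · subst h; simp [hbA]
          · simp [h]
        have hsA : ∑ e ∈ A, Function.update x b t e = t + ∑ e ∈ A.erase b, x e := by
          rw [← Finset.add_sum_erase A _ hbA, hxb _ hA0]; simp
        rw [hset, hsA]
        by_cases hC : π b ∈ C
        · have hbS : b ∈ S C := by simp [hS, hC, hb]
          rw [if_pos hC, Finset.insert_eq_of_mem (Finset.mem_union_right _ hbS)]
          linarith [hle _ hA0 C]
        · rw [if_neg hC]
          have := hmin (A.erase b, C) ⟨hA0, hC⟩
          simp only at this
          linarith [min_le_left α (r (π b))]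
      · have hA0 : A ⊆ T := fun e he => (Finset.mem_insert.1 (hA he)).resolve_left
          (fun h => hbA (h ▸ he))
        rw [hxb A hA0]
        by_cases hC : π b ∈ C
        · rw [if_pos hC]
          have hsplit : ∑ v ∈ C, r v = r (π b) + ∑ v ∈ C.erase (π b), r v :=
            (Finset.add_sum_erase C r hC).symm
          have hsub : S (C.erase (π b)) ⊆ (S C).erase b := by
            intro e
            simp only [hS, Finset.mem_filter, Finset.mem_univ, true_and, Finset.mem_erase]
            rintro ⟨⟨h1, h2⟩, h3⟩
            exact ⟨fun h => h1 (h ▸ rfl), h2, h3⟩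
          rcases min_choice α (r (π b)) with h | h
          -- The constraint of `(A₁, C₁)` has become tight and is uncrossed with the one to be
          -- proved.
          · have h1 := hf.submod (A ∪ (S C).erase b) (insert b (A₁ ∪ S C₁))
            have h2 := hle (A ∩ A₁) (Finset.inter_subset_left.trans hA0) (C ∩ C₁)
            have h3 := hle (A ∪ A₁) (Finset.union_subset hA0 hA₁) (C ∪ C₁)
            have h4 : f (A ∩ A₁ ∪ S (C ∩ C₁)) ≤
                f ((A ∪ (S C).erase b) ∩ insert b (A₁ ∪ S C₁)) := by
              refine hf.mono _ _ fun e => ?_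
              simp only [hS, Finset.mem_filter, Finset.mem_univ, true_and, Finset.mem_erase,
                Finset.mem_union, Finset.mem_inter, Finset.mem_insert]
              rintro (⟨h1, h2⟩ | ⟨⟨h1, h2⟩, h3⟩)
              · exact ⟨Or.inl h1, Or.inr (Or.inl h2)⟩
              · exact ⟨Or.inr ⟨fun h => hC₁ (h ▸ h2), h1, h3⟩, Or.inr (Or.inr ⟨h2, h3⟩)⟩
            have h5 : f (A ∪ A₁ ∪ S (C ∪ C₁)) ≤
                f ((A ∪ (S C).erase b) ∪ insert b (A₁ ∪ S C₁)) := by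
              refine hf.mono _ _ fun e => ?_
              simp only [hS, Finset.mem_filter, Finset.mem_univ, true_and, Finset.mem_erase,
                Finset.mem_union, Finset.mem_insert]
              tauto
            have h6 := Finset.sum_union_inter (s₁ := A) (s₂ := A₁) (f := x)
            have h7 := Finset.sum_union_inter (s₁ := C) (s₂ := C₁) (f := r)
            rw [ht, h]
            linarith
          -- Nothing is left for the class of `b`, so it can be dropped from `C`.
          · have h1 := hle A hA0 (C.erase (π b))
            have h2 := hf.mono _ _ (Finset.union_subset_union (subset_refl A) hsub)
            rw [ht, h, hsplit]
            linarith
        · rw [if_neg hC]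
          have hbS : b ∉ S C := by simp [hS, hC]
          rw [Finset.erase_eq_of_notMem hbS, sub_zero]
          exact hle A hA0 C

end IsPolymatroidRank

/-! ### Amounts of the buyers and merging of edges -/

/-- The amount of goods that buyer `k` transacts in `y`. -/
def amount {N M : Type} [Fintype M] (y : N × M → ℝ) (k : N) : ℝ := ∑ j, y (k, j)

section amount

variable {N M : Type} [Fintype M]

lemma amount_nonneg {y : N × M → ℝ} (hy : ∀ e, 0 ≤ y e) (k : N) : 0 ≤ amount y k :=
  Finset.sum_nonneg fun j _ => hy (k, j)

lemma amount_add (x y : N × M → ℝ) (k : N) : amount (x + y) k = amount x k + amount y k :=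
  Finset.sum_add_distrib

lemma amount_sub (x y : N × M → ℝ) (k : N) : amount (x - y) k = amount x k - amount y k :=
  Finset.sum_sub_distrib _ _

lemma sum_amount [Fintype N] (y : N × M → ℝ) : ∑ k, amount y k = ∑ e, y e :=
  (Fintype.sum_prod_type y).symm

lemma amount_le_sum [Fintype N] {y : N × M → ℝ} (hy : ∀ e, 0 ≤ y e) (k : N) :
    amount y k ≤ ∑ e, y e := by
  rw [← sum_amount]
  exact Finset.single_le_sum (f := amount y) (fun k _ => amount_nonneg hy k) (Finset.mem_univ k)

/-- Keep the edges at `i` and merge the edges at each other buyer. -/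
def splitMap [DecidableEq N] (i : N) (e : N × M) : M ⊕ N :=
  if e.1 = i then Sum.inl e.2 else Sum.inr e.1

/-- The vector with entries `ξ` on the edges at `i` and amounts `a` of the other buyers. -/
def splitVec [DecidableEq N] (i : N) (ξ : N × M → ℝ) (a : N → ℝ) : M ⊕ N → ℝ :=
  Sum.elim (fun j => ξ (i, j)) (fun k => if k = i then 0 else a k)

lemma sum_splitMap_inl [DecidableEq N] [DecidableEq M] [Fintype N] (i : N) (y : N × M → ℝ)
    (j : M) :
    ∑ e ∈ Finset.univ.filter (fun e => splitMap i e = Sum.inl j), y e = y (i, j) := by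
  have : Finset.univ.filter (fun e : N × M => splitMap i e = Sum.inl j) = {(i, j)} := by
    ext ⟨k, l⟩
    rw [Finset.mem_filter, splitMap]
    by_cases h : k = i <;> simp [h]
  rw [this, Finset.sum_singleton]

lemma sum_splitMap_inr [DecidableEq N] [DecidableEq M] [Fintype N] (i : N) (y : N × M → ℝ)
    (k : N) :
    ∑ e ∈ Finset.univ.filter (fun e => splitMap i e = Sum.inr k), y e =
      if k = i then 0 else amount y k := by
  split_ifs with hk
  · subst hk
    refine Finset.sum_eq_zero fun e he => ?_
    rw [Finset.mem_filter, splitMap] at he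
    by_cases h : e.1 = k
    · simp [h] at he
    · simp [h] at he
  · rw [Finset.sum_filter, Fintype.sum_prod_type, Finset.sum_eq_single k]
    · simp [splitMap, hk, amount]
    · intro l _ hl
      refine Finset.sum_eq_zero fun j _ => ?_
      by_cases h : l = i <;> simp [splitMap, h, hl]
    · simp

lemma sum_splitVec [DecidableEq N] [Fintype N] (i : N) (y : N × M → ℝ) (a : N → ℝ)
    (ha : ∀ k, k ≠ i → a k = amount y k) : ∑ c, splitVec i y a c = ∑ e, y e := by
  rw [Fintype.sum_sum_type, ← sum_amount,
    ← Finset.add_sum_erase _ (fun k => splitVec i y a (Sum.inr k)) (Finset.mem_univ i),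
    ← Finset.add_sum_erase _ (amount y) (Finset.mem_univ i)]
  simp only [splitVec, Sum.elim_inl, Sum.elim_inr, if_true, zero_add]
  rw [show ∑ j, y (i, j) = amount y i from rfl]
  congr 1
  refine Finset.sum_congr rfl fun k hk => ?_
  rw [Finset.mem_erase] at hk
  rw [if_neg hk.1, ha k hk.1]

lemma sum_sub_of_amount [DecidableEq N] [Fintype N] {y z : N × M → ℝ} {i : N}
    (h : ∀ k, k ≠ i → amount z k = amount y k) :
    ∑ e, z e = ∑ e, y e + (amount z i - amount y i) := by
  rw [← sum_amount, ← sum_amount, ← Finset.add_sum_erase _ _ (Finset.mem_univ i),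
    ← Finset.add_sum_erase _ (amount y) (Finset.mem_univ i),
    Finset.sum_congr rfl fun k hk => h k (Finset.mem_erase.1 hk).1]
  ring

end amount

/-! ### Remnant supply and clinching -/

namespace Market

variable {N M : Type} [DecidableEq N] [DecidableEq M]

lemma zero_mem_remnant {G : Market N M} {w : N × M → ℝ} {d : N → ℝ≥0∞}
    (hw : w ∈ G.polymatroid) : (0 : N × M → ℝ) ∈ G.remnant w d := by
  refine ⟨by simp, by simp, by simpa using hw, by simp⟩

lemma eq_zero_of_mem_clinchingPolytope {G : Market N M} {w : N × M → ℝ}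
    {d : N → ℝ≥0∞} {i : N} {ξ : N × M → ℝ} (hξ : ξ ∈ G.clinchingPolytope w d i) :
    (∀ e, e ∉ G.E → ξ e = 0) ∧ ∀ k, k ≠ i → ∀ j, ξ (k, j) = 0 := by
  refine ⟨fun e he => hξ.2.1 e fun h => he (Finset.mem_filter.1 h).1, fun k hk j =>
    hξ.2.1 _ fun h => hk (Finset.mem_filter.1 h).2⟩

variable [Fintype M]

/-- The rank function of the direct sum of the polymatroids of the sellers. -/
def rank (G : Market N M) (F : Finset (N × M)) : ℝ := ∑ j, G.f j (F ∩ G.sellerEdges j)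

lemma rank_isPolymatroidRank (G : Market N M) : IsPolymatroidRank G.rank where
  empty := by simp [rank, G.f_empty]
  mono := by
    intro A B hAB
    exact Finset.sum_le_sum fun j _ => G.f_mono j _ _ (Finset.inter_subset_inter_right hAB)
      Finset.inter_subset_right
  submod := by
    intro A B
    rw [rank, rank, rank, rank, ← Finset.sum_add_distrib, ← Finset.sum_add_distrib]
    refine Finset.sum_le_sum fun j _ => ?_
    have := G.f_submod j (A ∩ G.sellerEdges j) (B ∩ G.sellerEdges j) Finset.inter_subset_right
      Finset.inter_subset_right
    rwa [← Finset.inter_inter_distrib_right, ← Finset.union_inter_distrib_right] at this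

lemma rank_of_subset (G : Market N M) {j : M} {F : Finset (N × M)} (hF : F ⊆ G.sellerEdges j) :
    G.rank F = G.f j F := by
  rw [rank, Finset.sum_eq_single j]
  · rw [Finset.inter_eq_left.2 hF]
  · intro l _ hl
    have : F ∩ G.sellerEdges l = ∅ := by
      ext e
      simp only [Finset.mem_inter, Finset.notMem_empty, iff_false, not_and]
      intro h1 h2
      have h3 := hF h1
      simp only [sellerEdges, Finset.mem_filter] at h2 h3
      exact hl (h2.2.symm.trans h3.2)
    rw [this, G.f_empty]
  · simp

lemma sum_eq_sum_sellers (G : Market N M) {y : N × M → ℝ} (hy : ∀ e, e ∉ G.E → y e = 0)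
    (F : Finset (N × M)) : ∑ e ∈ F, y e = ∑ j, ∑ e ∈ F ∩ G.sellerEdges j, y e := by
  have h1 : ∀ j, ∑ e ∈ F ∩ G.sellerEdges j, y e = ∑ e ∈ F with e.2 = j, y e := by
    intro j
    refine Finset.sum_subset (fun e => ?_) (fun e he hne => hy e fun hE => hne ?_)
    · simp only [sellerEdges, Finset.mem_inter, Finset.mem_filter]
      tauto
    · simp only [sellerEdges, Finset.mem_inter, Finset.mem_filter] at he ⊢
      exact ⟨he.1, hE, he.2⟩
  simp only [h1]
  exact (Finset.sum_fiberwise F (fun e => e.2) y).symm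

/-- Pairs outside `E` have rank zero, so the direct sum is one polymatroid on all pairs, without a
separate support condition. -/
lemma mem_polymatroid_iff (G : Market N M) {w : N × M → ℝ} :
    w ∈ G.polymatroid ↔ w ∈ indepVectors G.rank := by
  constructor
  · rintro ⟨h0, hE, hle⟩
    refine ⟨h0, fun F => ?_⟩
    rw [G.sum_eq_sum_sellers hE]
    exact Finset.sum_le_sum fun j _ => hle j _ Finset.inter_subset_right
  · rintro ⟨h0, hle⟩
    refine ⟨h0, fun e he => ?_, fun j F hF => ?_⟩
    · refine le_antisymm ?_ (h0 e)
      have := hle {e}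
      have h2 : G.rank {e} = 0 := by
        refine Finset.sum_eq_zero fun j _ => ?_
        rw [Finset.singleton_inter_of_notMem, G.f_empty]
        exact fun h => he (Finset.mem_filter.1 h).1
      simpa [h2] using this
    · exact G.rank_of_subset hF ▸ hle F

lemma sum_buyerEdges (G : Market N M) {y : N × M → ℝ} (hy : ∀ e, e ∉ G.E → y e = 0) (k : N) :
    ∑ e ∈ G.buyerEdges k, y e = amount y k := by
  have h : ∑ e ∈ G.buyerEdges k, y e =
      ∑ e ∈ Finset.univ.map ⟨fun j : M => (k, j), fun a b h => (Prod.mk.inj h).2⟩, y e := by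
    refine Finset.sum_subset (fun e => ?_) (fun e he hne => hy e fun hE => hne ?_)
    · simp only [buyerEdges, Finset.mem_filter, Finset.mem_map, Finset.mem_univ, true_and]
      rintro ⟨-, rfl⟩
      exact ⟨e.2, rfl⟩
    · obtain ⟨j, -, rfl⟩ := Finset.mem_map.1 he
      exact Finset.mem_filter.2 ⟨hE, rfl⟩
  rw [h, Finset.sum_map]
  rfl

lemma mem_remnant_add_iff {G : Market N M} {w : N × M → ℝ}
    {d : N → ℝ≥0∞} {i : N} {ξ : N × M → ℝ} (hξ : ξ ∈ G.clinchingPolytope w d i)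
    {d' : N → ℝ≥0∞} (hdk : ∀ k, k ≠ i → d' k = d k)
    (hdi : ∀ x, 0 ≤ x → (ENNReal.ofReal x ≤ d' i ↔ ENNReal.ofReal (x + amount ξ i) ≤ d i))
    {y : N × M → ℝ} (hy : ∀ e, 0 ≤ y e) :
    y ∈ G.remnant (w + ξ) d' ↔ ξ + y ∈ G.remnant w d := by
  obtain ⟨hξE, hξk⟩ := eq_zero_of_mem_clinchingPolytope hξ
  have hamt : ∀ k, k ≠ i → amount (ξ + y) k = amount y k := by
    intro k hk
    rw [amount_add]
    simp [amount, hξk k hk]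
  have hE : (∀ e, e ∉ G.E → (ξ + y) e = 0) ↔ ∀ e, e ∉ G.E → y e = 0 := by
    refine forall₂_congr fun e he => ?_
    rw [Pi.add_apply, hξE e he, zero_add]
  constructor
  · rintro ⟨-, h2, h3, h4⟩
    refine ⟨fun e => add_nonneg (hξ.1 e) (hy e), hE.2 h2, by rwa [← add_assoc], fun k => ?_⟩
    rw [G.sum_buyerEdges (hE.2 h2)]
    have h5 := h4 k
    rw [G.sum_buyerEdges h2] at h5
    by_cases hk : k = i
    · subst hk
      rw [amount_add, add_comm]
      exact (hdi _ (amount_nonneg hy k)).1 h5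
    · rw [hamt k hk, ← hdk k hk]; exact h5
  · rintro ⟨-, h2, h3, h4⟩
    refine ⟨hy, hE.1 h2, by rwa [add_assoc], fun k => ?_⟩
    rw [G.sum_buyerEdges (hE.1 h2)]
    have h5 := h4 k
    rw [G.sum_buyerEdges h2] at h5
    by_cases hk : k = i
    · subst hk
      rw [amount_add, add_comm] at h5
      exact (hdi _ (amount_nonneg hy k)).2 h5
    · rw [hamt k hk, ← hdk k hk] at h5; exact h5

variable [Fintype N]

/-- The rank function of what can be added to `w`, seen from buyer `i`: the edges at `i` are kept
apart and the edges of each other buyer are merged. -/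
def splitRank (G : Market N M) (w : N × M → ℝ) (i : N) (A : Finset (M ⊕ N)) : ℝ :=
  contractRank G.rank w (Finset.univ.filter (fun e => splitMap i e ∈ A))

variable {G : Market N M} {w : N × M → ℝ} {d : N → ℝ≥0∞} {i : N} {ξ : N × M → ℝ}

lemma splitRank_isPolymatroidRank (hw : w ∈ G.polymatroid) :
    IsPolymatroidRank (G.splitRank w i) :=
  (G.rank_isPolymatroidRank.contract (G.mem_polymatroid_iff.1 hw)).aggregate (splitMap i)

lemma mem_remnant_iff (hw : w ∈ G.polymatroid) {y : N × M → ℝ} :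
    y ∈ G.remnant w d ↔ y ∈ indepVectors (contractRank G.rank w) ∧
      ∀ k, ENNReal.ofReal (amount y k) ≤ d k := by
  constructor
  · rintro ⟨h0, hE, hP, hd⟩
    refine ⟨(IsPolymatroidRank.mem_contract_iff hw.1 h0).2 (G.mem_polymatroid_iff.1 hP),
      fun k => ?_⟩
    rw [← G.sum_buyerEdges hE]
    exact hd k
  · rintro ⟨h, hd⟩
    have hP := G.mem_polymatroid_iff.2 ((IsPolymatroidRank.mem_contract_iff hw.1 h.1).1 h)
    have hE : ∀ e, e ∉ G.E → y e = 0 := by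
      intro e he
      have := hP.2.1 e he
      rwa [Pi.add_apply, hw.2.1 e he, zero_add] at this
    exact ⟨h.1, hE, hP, fun k => (G.sum_buyerEdges hE k).symm ▸ hd k⟩

lemma splitVec_amount_mem {y : N × M → ℝ}
    (hy : y ∈ indepVectors (contractRank G.rank w)) :
    splitVec i y (amount y) ∈ indepVectors (G.splitRank w i) := by
  have h : splitVec i y (amount y) =
      fun c => ∑ e ∈ Finset.univ.filter (fun e => splitMap i e = c), y e := by
    funext c
    rcases c with j | k
    · rw [sum_splitMap_inl]; rfl
    · rw [sum_splitMap_inr]; rfl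
  rw [h]
  exact IsPolymatroidRank.aggregate_mem (splitMap i) hy

lemma exists_of_splitVec_mem (hw : w ∈ G.polymatroid) {a : N → ℝ}
    (h : splitVec i ξ a ∈ indepVectors (G.splitRank w i)) :
    ∃ y ∈ indepVectors (contractRank G.rank w), (∀ j, y (i, j) = ξ (i, j)) ∧
      ∀ k, k ≠ i → amount y k = a k := by
  obtain ⟨y, hy, hsum⟩ := (G.rank_isPolymatroidRank.contract
    (G.mem_polymatroid_iff.1 hw)).exists_split (splitMap i) h
  refine ⟨y, hy, fun j => ?_, fun k hk => ?_⟩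
  · rw [← sum_splitMap_inl i y j, hsum]; rfl
  · have := hsum (Sum.inr k)
    rw [sum_splitMap_inr, if_neg hk] at this
    rw [this, splitVec, Sum.elim_inr, if_neg hk]

lemma remnant_of_le (hw : w ∈ G.polymatroid) {y z : N × M → ℝ} (hy : y ∈ G.remnant w d)
    (hz : ∀ e, 0 ≤ z e) (hzy : z ≤ y) : z ∈ G.remnant w d := by
  rw [mem_remnant_iff hw] at hy ⊢
  exact ⟨⟨hz, fun F => (Finset.sum_le_sum fun e _ => hzy e).trans (hy.1.2 F)⟩, fun k =>
    (ENNReal.ofReal_le_ofReal (Finset.sum_le_sum fun j _ => hzy (k, j))).trans (hy.2 k)⟩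

/-- Whatever the others may still get, they may also get when `i` gets exactly `ξ`. -/
lemma exists_of_mem_clinchingPolytope (hw : w ∈ G.polymatroid)
    (hξ : ξ ∈ G.clinchingPolytope w d i) {y : N × M → ℝ} (hy : y ∈ G.remnant w d) :
    ∃ z ∈ G.remnant w d, (∀ j, z (i, j) = ξ (i, j)) ∧ ∀ k, k ≠ i → amount z k = amount y k := by
  set y₀ : N × M → ℝ := fun e => if e.1 = i then 0 else y e with hy₀
  have h0 : y₀ ∈ G.remnant w d := by
    refine remnant_of_le hw hy (fun e => ?_) (fun e => ?_)
    · simp only [hy₀]; split_ifs <;> [rfl; exact hy.1 e]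
    · simp only [hy₀]; split_ifs <;> [exact hy.1 e; rfl]
  have hamt : ∀ k, k ≠ i → amount y₀ k = amount y k := by
    intro k hk
    simp [amount, hy₀, hk]
  have hmem : (fun k : {k : N // k ≠ i} => amount y k) ∈ G.othersPolytope w d i 0 := by
    refine ⟨y₀, h0, fun e he => ?_, fun k => ?_⟩
    · simp [hy₀, (Finset.mem_filter.1 he).2]
    · rw [G.sum_buyerEdges h0.2.1, hamt k k.2]
  rw [← hξ.2.2] at hmem
  obtain ⟨z, hz, hzi, hzk⟩ := hmem
  refine ⟨z, hz, fun j => ?_, fun k hk => ?_⟩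
  · by_cases h : (i, j) ∈ G.buyerEdges i
    · exact hzi _ h
    · rw [hξ.2.1 _ h, hz.2.1]
      exact fun hE => h (Finset.mem_filter.2 ⟨hE, rfl⟩)
  · rw [← G.sum_buyerEdges hz.2.1]
    exact hzk ⟨k, hk⟩

lemma mem_clinchingPolytope (hw : w ∈ G.polymatroid) (h0 : ∀ e, 0 ≤ ξ e)
    (hE : ∀ e, e ∉ G.buyerEdges i → ξ e = 0)
    (h : ∀ y ∈ G.remnant w d, (∀ j, y (i, j) = 0) →
      ∃ z ∈ G.remnant w d, (∀ j, z (i, j) = ξ (i, j)) ∧ ∀ k, k ≠ i → amount z k = amount y k) :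
    ξ ∈ G.clinchingPolytope w d i := by
  refine ⟨h0, hE, Set.Subset.antisymm ?_ ?_⟩
  · rintro u ⟨y, hy, hyi, hyk⟩
    refine ⟨fun e => if e.1 = i then 0 else y e, ?_, ?_, ?_⟩
    · refine remnant_of_le hw hy (fun e => ?_) (fun e => ?_)
      · split_ifs <;> [rfl; exact hy.1 e]
      · show (if e.1 = i then 0 else y e) ≤ y e
        split_ifs <;> [exact hy.1 e; rfl]
    · intro e he
      simp [(Finset.mem_filter.1 he).2]
    · intro k
      rw [← hyk k]
      refine Finset.sum_congr rfl fun e he => if_neg ?_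
      rw [(Finset.mem_filter.1 he).2]
      exact k.2
  · rintro u ⟨y, hy, hyi, hyk⟩
    have hy0 : ∀ j, y (i, j) = 0 := by
      intro j
      by_cases hE : (i, j) ∈ G.E
      · exact hyi _ (Finset.mem_filter.2 ⟨hE, rfl⟩)
      · exact hy.2.1 _ hE
    obtain ⟨z, hz, hzi, hzk⟩ := h y hy hy0
    refine ⟨z, hz, fun e he => ?_, fun k => ?_⟩
    · have := (Finset.mem_filter.1 he).2
      subst this
      exact hzi e.2
    · rw [← hyk k, G.sum_buyerEdges hz.2.1, G.sum_buyerEdges hy.2.1, hzk k k.2]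

lemma clinched_mem_remnant (hw : w ∈ G.polymatroid) (hξ : ξ ∈ G.clinchingPolytope w d i) :
    ξ ∈ G.remnant w d := by
  obtain ⟨z, hz, hzi, -⟩ := exists_of_mem_clinchingPolytope hw hξ (zero_mem_remnant hw)
  refine remnant_of_le hw hz hξ.1 ?_
  rintro ⟨k, j⟩
  by_cases hk : k = i
  · subst hk; exact (hzi j).ge
  · rw [(eq_zero_of_mem_clinchingPolytope hξ).2 k hk j]; exact hz.1 _

/-- The effect of a clinching step on the future amounts: only those of the clinching buyer change,
by the clinched amount. -/
lemma exists_remnant_after_clinch (hw : w ∈ G.polymatroid) (hξ : ξ ∈ G.clinchingPolytope w d i)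
    {d' : N → ℝ≥0∞} (hdk : ∀ k, k ≠ i → d' k = d k)
    (hdi : ∀ x, 0 ≤ x → (ENNReal.ofReal x ≤ d' i ↔ ENNReal.ofReal (x + amount ξ i) ≤ d i))
    {y : N × M → ℝ} (hy : y ∈ G.remnant w d) :
    ∃ z ∈ G.remnant (w + ξ) d', (∀ k, k ≠ i → amount z k = amount y k) ∧
      amount z i = max (amount y i - amount ξ i) 0 := by
  obtain ⟨hξE, hξk⟩ := eq_zero_of_mem_clinchingPolytope hξ
  have hξ0 : ∀ k, k ≠ i → amount ξ k = 0 := fun k hk => by simp [amount, hξk k hk]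
  obtain ⟨z, hz, hzi, hzk⟩ := exists_of_mem_clinchingPolytope hw hξ hy
  have hsub : ∀ z' ∈ G.remnant w d, (∀ j, ξ (i, j) ≤ z' (i, j)) →
      z' - ξ ∈ G.remnant (w + ξ) d' := by
    intro z' hz' hle
    rw [mem_remnant_add_iff hξ hdk hdi, add_sub_cancel]
    · exact hz'
    · rintro ⟨k, j⟩
      by_cases hk : k = i
      · subst hk; exact sub_nonneg.2 (hle j)
      · rw [Pi.sub_apply, hξk k hk, sub_zero]; exact hz'.1 _
  rcases le_total (amount y i) (amount ξ i) with hle | hle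
  · refine ⟨z - ξ, hsub z hz fun j => (hzi j).ge, fun k hk => ?_, ?_⟩
    · rw [amount_sub, hξ0 k hk, sub_zero, hzk k hk]
    · rw [max_eq_right (by linarith), amount_sub, sub_eq_zero]
      simp [amount, hzi]
  · have hzP := (mem_remnant_iff hw).1 hz
    have hyP := (mem_remnant_iff hw).1 hy
    -- Clinchability of `ξ`: it is compatible with the amounts that `y` gives to the others.
    have hx : splitVec i ξ (amount y) ∈ indepVectors (G.splitRank w i) := by
      have := splitVec_amount_mem (i := i) hzP.1
      convert this using 1
      ext c
      rcases c with j | k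
      · simp [splitVec, hzi]
      · by_cases hk : k = i <;> simp [splitVec, hk, hzk]
    -- In the augmentation towards `y` the coordinates of the others agree already, so only entries
    -- at `i` grow, to a total `τ` of at least `amount y i`.
    obtain ⟨v, hv, hxv, hvx, hsum⟩ := (splitRank_isPolymatroidRank hw).exists_augment hx
      (splitVec_amount_mem (i := i) hyP.1)
    set δ := amount ξ i
    set τ := ∑ j, v (Sum.inl j) with hτ
    have hvk : ∀ k, v (Sum.inr k) = if k = i then 0 else amount y k := by
      intro k
      have h1 := hxv (Sum.inr k)
      have h2 := hvx (Sum.inr k)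
      rw [Pi.sup_apply] at h2
      simp only [splitVec, Sum.elim_inr, sup_idem] at h1 h2
      exact le_antisymm h2 h1
    have hτy : amount y i ≤ τ := by
      rw [Fintype.sum_sum_type, Fintype.sum_sum_type] at hsum
      simp only [hvk] at hsum
      simp only [splitVec, Sum.elim_inl, Sum.elim_inr] at hsum
      have : ∑ j, y (i, j) ≤ τ := by linarith
      exact this
    have hvξ : ∀ j, ξ (i, j) ≤ v (Sum.inl j) := fun j => hxv (Sum.inl j)
    -- A convex combination of `ξ` and `v` on the edges at `i` meets the total `amount y i` exactly.
    obtain ⟨t, ht0, ht1, ht⟩ : ∃ t : ℝ, 0 ≤ t ∧ t ≤ 1 ∧ δ + t * (τ - δ) = amount y i := by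
      rcases eq_or_lt_of_le (hle.trans hτy) with h | h
      · refine ⟨0, le_rfl, zero_le_one, ?_⟩
        rw [zero_mul, add_zero]
        linarith
      · refine ⟨(amount y i - δ) / (τ - δ), div_nonneg (by linarith) (by linarith),
          (div_le_one (by linarith)).2 (by linarith), ?_⟩
        rw [div_mul_cancel₀ _ (by linarith)]; ring
    set ζ : N × M → ℝ := fun e => ξ e + t * (v (Sum.inl e.2) - ξ e) with hζ
    have hζle : ∀ j, ζ (i, j) ≤ v (Sum.inl j) := by
      intro j
      simp only [hζ]
      nlinarith [hvξ j]
    have hξζ : ∀ j, ξ (i, j) ≤ ζ (i, j) := by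
      intro j
      simp only [hζ]
      nlinarith [hvξ j]
    have hζmem : splitVec i ζ (amount y) ∈ indepVectors (G.splitRank w i) := by
      refine ⟨?_, fun F => le_trans (Finset.sum_le_sum fun c _ => ?_) (hv.2 F)⟩
      · rintro (j | k)
        · exact (hξ.1 _).trans (hξζ j)
        · exact hx.1 (Sum.inr k)
      · rcases c with j | k
        · exact hζle j
        · exact (hvk k).ge
    obtain ⟨z', hz', hz'i, hz'k⟩ := exists_of_splitVec_mem hw hζmem
    have hz'amt : amount z' i = amount y i := by
      rw [← ht]
      simp only [amount, hz'i, hζ]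
      rw [Finset.sum_add_distrib, ← Finset.mul_sum, Finset.sum_sub_distrib]
      rfl
    have hz'R : z' ∈ G.remnant w d := by
      rw [mem_remnant_iff hw]
      refine ⟨hz', fun k => ?_⟩
      by_cases hk : k = i
      · rw [hk, hz'amt]; exact hyP.2 i
      · rw [hz'k k hk]; exact hyP.2 k
    refine ⟨z' - ξ, hsub z' hz'R fun j => (hz'i j).symm ▸ hξζ j, fun k hk => ?_, ?_⟩
    · rw [amount_sub, hξ0 k hk, sub_zero, hz'k k hk]
    · rw [max_eq_left (by linarith), amount_sub, hz'amt]

lemma sum_eq_of_clinched (hξ : ξ ∈ G.clinchingPolytope w d i) : ∑ e, ξ e = amount ξ i := by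
  rw [← sum_amount, Finset.sum_eq_single i]
  · intro k _ hk
    simp [amount, (eq_zero_of_mem_clinchingPolytope hξ).2 k hk]
  · simp

/-- A vector of maximal total amount gives the clinching buyer at least the clinched amount. -/
lemma amount_clinched_le (hw : w ∈ G.polymatroid) (hξ : ξ ∈ G.clinchingPolytope w d i)
    {y : N × M → ℝ} (hy : y ∈ G.remnant w d)
    (hmax : ∀ z ∈ G.remnant w d, ∑ e, z e ≤ ∑ e, y e) : amount ξ i ≤ amount y i := by
  obtain ⟨z, hz, hzi, hzk⟩ := exists_of_mem_clinchingPolytope hw hξ hy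
  have h := hmax z hz
  rw [← sum_amount, ← sum_amount, ← Finset.add_sum_erase _ _ (Finset.mem_univ i),
    ← Finset.add_sum_erase _ (amount y) (Finset.mem_univ i)] at h
  have h2 : ∑ k ∈ Finset.univ.erase i, amount z k = ∑ k ∈ Finset.univ.erase i, amount y k :=
    Finset.sum_congr rfl fun k hk => hzk k (Finset.mem_erase.1 hk).1
  have h3 : amount z i = amount ξ i := by simp [amount, hzi]
  linarith

/-- If buyer `i` can clinch nothing, then the others can absorb the whole remaining supply. -/
lemma exists_maximum_without (hw : w ∈ G.polymatroid)
    (h : ∀ ξ ∈ G.clinchingPolytope w d i, ξ = 0) :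
    ∃ y ∈ G.remnant w d, amount y i = 0 ∧ ∀ z ∈ G.remnant w d, ∑ e, z e ≤ ∑ e, y e := by
  have hh := splitRank_isPolymatroidRank (i := i) hw
  set r := G.splitRank w i with hr
  -- Caps for vectors that give nothing to `i`; truncating the demands at the total rank makes them
  -- finite and excludes nothing.
  set b : M ⊕ N → ℝ := Sum.elim (fun _ => 0)
    (fun k => if k = i then 0 else (min (d k) (ENNReal.ofReal (r Finset.univ))).toReal) with hb
  have hbtop : ∀ k, min (d k) (ENNReal.ofReal (r Finset.univ)) ≠ ⊤ := fun k =>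
    ne_top_of_le_ne_top ENNReal.ofReal_ne_top (min_le_right _ _)
  have hb0 : 0 ≤ b := by
    rintro (j | k)
    · exact le_rfl
    · simp only [hb, Sum.elim_inr]; split_ifs <;> [exact le_rfl; exact ENNReal.toReal_nonneg]
  have h0 : (0 : M ⊕ N → ℝ) ∈ indepVectors r := by
    refine ⟨by simp, fun F => ?_⟩
    simpa [hh.empty] using hh.mono ∅ F (Finset.empty_subset F)
  have hamtb : ∀ y ∈ G.remnant w d, ∀ k, splitVec i y (amount y) (Sum.inr k) ≤ b (Sum.inr k) := by
    intro y hy k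
    have hyP := (mem_remnant_iff hw).1 hy
    have hs := splitVec_amount_mem (i := i) hyP.1
    by_cases hk : k = i
    · simp [splitVec, hb, hk]
    · simp only [splitVec, hb, Sum.elim_inr, if_neg hk]
      rw [← ENNReal.ofReal_le_iff_le_toReal (hbtop k)]
      refine le_min (hyP.2 k) (ENNReal.ofReal_le_ofReal ?_)
      refine (amount_le_sum hy.1 k).trans ?_
      rw [← sum_splitVec i y (amount y) (fun _ _ => rfl)]
      exact hs.2 Finset.univ
  obtain ⟨z, hz, -, hzb, T, hT, hTmax, hoff⟩ := hh.exists_maximal_tight h0 hb0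
  have hz0 : ∀ j, z (Sum.inl j) = 0 := fun j => le_antisymm (hzb (Sum.inl j)) (hz.1 _)
  -- If no tight set contains the edge to `j`, all sets containing it have slack at least some `σ >
  -- 0`. With positive demand, `i` could then clinch a small amount there.
  have hTj : ∀ j, Sum.inl j ∉ T → d i = 0 := by
    intro j hj
    by_contra hd
    obtain ⟨A₀, hA₀, hmin⟩ := Finset.exists_min_image
      ((Finset.univ : Finset (Finset (M ⊕ N))).filter (fun A => Sum.inl j ∈ A))
      (fun A => r A - ∑ a ∈ A, z a) ⟨{Sum.inl j}, by simp⟩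
    simp only [Finset.mem_filter, Finset.mem_univ, true_and] at hA₀ hmin
    set σ := r A₀ - ∑ a ∈ A₀, z a with hσ
    have hσ0 : 0 < σ := by
      rcases lt_or_eq_of_le (hz.2 A₀) with h1 | h1
      · exact sub_pos.2 h1
      · exact absurd (hTmax A₀ h1 hA₀) hj
    have hm1 : min (d i) 1 ≠ ⊤ := ne_top_of_le_ne_top ENNReal.one_ne_top (min_le_right _ _)
    set α := min σ (min (d i) 1).toReal with hα
    have hα0 : 0 < α := by
      refine lt_min hσ0 (ENNReal.toReal_pos ?_ hm1)
      exact (lt_min (pos_iff_ne_zero.2 hd) one_pos).ne'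
    have hαd : ENNReal.ofReal α ≤ d i :=
      ((ENNReal.ofReal_le_iff_le_toReal hm1).2 (min_le_right _ _)).trans (min_le_left _ _)
    set η : N × M → ℝ := Pi.single (i, j) α with hη
    have hη0 : ∀ e, 0 ≤ η e := by
      intro e
      by_cases he : e = (i, j)
      · subst he; simpa [hη] using hα0.le
      · simp [hη, he]
    have key : ∀ y ∈ G.remnant w d, (∀ j, y (i, j) = 0) →
        ∃ v ∈ G.remnant w d, (∀ j, v (i, j) = η (i, j)) ∧
          ∀ k, k ≠ i → amount v k = amount y k := by
      intro y hy hyi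
      have hyP := (mem_remnant_iff hw).1 hy
      have hx := splitVec_amount_mem (i := i) hyP.1
      rw [← hr] at hx
      have hsplit : splitVec i η (amount y) =
          splitVec i y (amount y) + Pi.single (Sum.inl j) α := by
        ext c
        rcases c with l | k
        · by_cases hl : l = j
          · subst hl; simp [splitVec, hη, hyi]
          · simp [splitVec, hη, hyi, hl]
        · simp [splitVec]
      have hmem : splitVec i η (amount y) ∈ indepVectors r := by
        refine ⟨?_, fun A => ?_⟩
        · rintro (l | k)
          · exact hη0 _
          · exact hx.1 (Sum.inr k)
        · rw [hsplit, IsPolymatroidRank.sum_add_single]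
          split_ifs with hjA
          -- Off `T` the vector `z` dominates `y`. Uncrossing `A` with the tight set `T` therefore
          -- transfers the slack of `A ∪ T` under `z` to `A` under `y`.
          · have h1 : ∑ c ∈ A, splitVec i y (amount y) c =
                ∑ c ∈ A ∩ T, splitVec i y (amount y) c + ∑ c ∈ A \ T, splitVec i y (amount y) c :=
              (Finset.sum_inter_add_sum_sdiff A T _).symm
            have h2 : ∑ c ∈ A \ T, splitVec i y (amount y) c ≤ ∑ c ∈ A \ T, z c := by
              refine Finset.sum_le_sum fun c hc => ?_
              rw [hoff c (Finset.mem_sdiff.1 hc).2]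
              rcases c with l | k
              · exact (hyi l).le
              · exact hamtb y hy k
            have h3 : ∑ c ∈ A ∪ T, z c = ∑ c ∈ A \ T, z c + ∑ c ∈ T, z c := by
              rw [← Finset.sum_union Finset.sdiff_disjoint, Finset.sdiff_union_self_eq_union]
            have h4 := hmin (A ∪ T) (Finset.mem_union_left _ hjA)
            linarith [hh.submod A T, hx.2 (A ∩ T), min_le_left σ (min (d i) 1).toReal]
          · rw [add_zero]; exact hx.2 A
      obtain ⟨v, hv, hvi, hvk⟩ := exists_of_splitVec_mem hw hmem
      refine ⟨v, (mem_remnant_iff hw).2 ⟨hv, fun k => ?_⟩, hvi, hvk⟩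
      by_cases hk : k = i
      · subst hk
        have : amount v k = α := by
          rw [amount]
          simp only [hvi, hη, Pi.single_apply, Prod.mk.injEq, true_and]
          simp
        rwa [this]
      · rw [hvk k hk]; exact hyP.2 k
    have hE : (i, j) ∈ G.E := by
      by_contra hE
      obtain ⟨v, hv, hvi, -⟩ := key 0 (zero_mem_remnant hw) (by simp)
      have h1 := hvi j
      rw [hv.2.1 _ hE] at h1
      simp [hη] at h1
      exact hα0.ne h1
    have := h η (mem_clinchingPolytope hw hη0 (fun e he => ?_) key)
    · have h2 := congrFun this (i, j)
      simp [hη] at h2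
      exact hα0.ne' h2
    · have : e ≠ (i, j) := by
        rintro rfl
        exact he (Finset.mem_filter.2 ⟨hE, rfl⟩)
      simp [hη, this]
  have hzs : splitVec i 0 (fun k => z (Sum.inr k)) = z := by
    ext c
    rcases c with j | k
    · simp [splitVec, hz0]
    · by_cases hk : k = i
      · subst hk
        simp only [splitVec, Sum.elim_inr, if_true]
        refine le_antisymm (hz.1 _) ?_
        simpa [hb] using hzb (Sum.inr k)
      · simp [splitVec, hk]
  obtain ⟨y, hy, hyi, hyk⟩ := exists_of_splitVec_mem (ξ := 0) (a := fun k => z (Sum.inr k)) hw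
    (by rw [hzs]; exact hz)
  have hyi0 : amount y i = 0 := by simp [amount, hyi]
  have hyR : y ∈ G.remnant w d := by
    refine (mem_remnant_iff hw).2 ⟨hy, fun k => ?_⟩
    by_cases hk : k = i
    · subst hk; simp [hyi0]
    · rw [hyk k hk]
      refine ((ENNReal.ofReal_le_iff_le_toReal (hbtop k)).2 ?_).trans (min_le_left _ _)
      simpa [hb, hk] using hzb (Sum.inr k)
  refine ⟨y, hyR, hyi0, fun x hx => ?_⟩
  have hxP := (mem_remnant_iff hw).1 hx
  have hxs := splitVec_amount_mem (i := i) hxP.1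
  have hyz : ∑ e, y e = ∑ c, z c := by
    rw [← sum_splitVec i y _ fun _ _ => rfl]
    refine Finset.sum_congr rfl fun c _ => ?_
    rw [← hzs]
    rcases c with j | k
    · simpa [splitVec] using hyi j
    · by_cases hk : k = i <;> simp [splitVec, hk, hyk]
  rw [hyz, ← sum_splitVec i x _ fun _ _ => rfl, ← Finset.sum_add_sum_compl T z,
    ← Finset.sum_add_sum_compl T]
  -- On `T` the rank bounds `x`; off `T` the caps do, or the zero demand on the edges at `i`.
  refine add_le_add (hT ▸ hxs.2 T) (Finset.sum_le_sum fun c hc => ?_)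
  rw [Finset.mem_compl] at hc
  rw [hoff c hc]
  rcases c with j | k
  · have hd := hTj j hc
    have h1 := hxP.2 i
    rw [hd, nonpos_iff_eq_zero, ENNReal.ofReal_eq_zero] at h1
    exact (Finset.single_le_sum (f := fun j => x (i, j)) (fun j _ => hx.1 (i, j))
      (Finset.mem_univ j)).trans h1
  · exact hamtb x hx k

/-- After clinching a maximal vector there is nothing left to clinch. -/
lemma eq_zero_of_maximal_clinched (hw : w ∈ G.polymatroid)
    (hξ : Maximal (fun ξ => ξ ∈ G.clinchingPolytope w d i) ξ)
    {d' : N → ℝ≥0∞} (hdk : ∀ k, k ≠ i → d' k = d k)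
    (hdi : ∀ x, 0 ≤ x → (ENNReal.ofReal x ≤ d' i ↔ ENNReal.ofReal (x + amount ξ i) ≤ d i)) :
    ∀ η ∈ G.clinchingPolytope (w + ξ) d' i, η = 0 := by
  intro η hη
  have hξ1 := hξ.1
  -- Two successive clinches compose to a single one, against the maximality of `ξ` unless `η = 0`.
  have hmem : ξ + η ∈ G.clinchingPolytope w d i := by
    refine mem_clinchingPolytope hw (fun e => add_nonneg (hξ1.1 e) (hη.1 e)) (fun e he => ?_) ?_
    · rw [Pi.add_apply, hξ1.2.1 e he, hη.2.1 e he, add_zero]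
    · intro y hy hyi
      obtain ⟨z, hz, hzi, hzk⟩ := exists_of_mem_clinchingPolytope hw hξ1 hy
      have hξz : ξ ≤ z := by
        rintro ⟨k, j⟩
        by_cases hk : k = i
        · subst hk; exact (hzi j).ge
        · rw [(eq_zero_of_mem_clinchingPolytope hξ1).2 k hk j]; exact hz.1 _
      have hz' : z - ξ ∈ G.remnant (w + ξ) d' := by
        rw [mem_remnant_add_iff (y := z - ξ) hξ1 hdk hdi fun e => sub_nonneg.2 (hξz e),
          add_sub_cancel]
        exact hz
      have hw' : w + ξ ∈ G.polymatroid := (clinched_mem_remnant hw hξ1).2.2.1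
      obtain ⟨v, hv, hvi, hvk⟩ := exists_of_mem_clinchingPolytope hw' hη hz'
      refine ⟨ξ + v, (mem_remnant_add_iff hξ1 hdk hdi hv.1).1 hv, fun j => ?_, fun k hk => ?_⟩
      · simp [hvi]
      · have : amount ξ k = 0 := by
          simp [amount, (eq_zero_of_mem_clinchingPolytope hξ1).2 k hk]
        rw [amount_add, hvk k hk, amount_sub, this, hzk k hk]; ring
  have hle := hξ.2 hmem (fun e => le_add_of_nonneg_right (hη.1 e))
  ext e
  have := hle e
  simp only [Pi.add_apply] at this
  exact le_antisymm (by simpa using this) (hη.1 e)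

/-- A buyer clinches nothing from a seller whose whole supply may be taken by another buyer with
infinite demand. -/
lemma clinched_eq_zero_of_top (hw : w ∈ G.polymatroid) (hξ : ξ ∈ G.clinchingPolytope w d i)
    {j : M} {k : N} (hki : k ≠ i) (hkE : (k, j) ∈ G.E) (honly : ∀ l, (k, l) ∈ G.E → l = j)
    (hf : ∀ F ⊆ G.sellerEdges j, (k, j) ∈ F → G.f j F = G.f j (G.sellerEdges j))
    (hd : d k = ⊤) : ξ (i, j) = 0 := by
  -- Here `t` is all that `j` has left. Buyer `k` may take it, so she may still take it when `i`
  -- gets `ξ`, and then nothing of `j` remains for `i`.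
  set t := G.f j (G.sellerEdges j) - ∑ e ∈ G.sellerEdges j, w e with ht
  have ht0 : 0 ≤ t := sub_nonneg.2 (hw.2.2 j _ (subset_refl _))
  have hkj : (k, j) ∈ G.sellerEdges j := Finset.mem_filter.2 ⟨hkE, rfl⟩
  set y : N × M → ℝ := Pi.single (k, j) t with hy
  have hyE : ∀ e, e ∉ G.E → y e = 0 := by
    intro e he
    have : e ≠ (k, j) := by rintro rfl; exact he hkE
    simp [hy, this]
  have hy0 : ∀ e, 0 ≤ y e := by
    intro e
    by_cases h : e = (k, j)
    · subst h; simpa [hy] using ht0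
    · simp [hy, h]
  have hyR : y ∈ G.remnant w d := by
    refine ⟨hy0, hyE, ⟨fun e => add_nonneg (hw.1 e) (hy0 e), fun e he => ?_, fun l F hF => ?_⟩,
      fun l => ?_⟩
    · rw [Pi.add_apply, hw.2.1 e he, hyE e he, add_zero]
    · rw [hy, IsPolymatroidRank.sum_add_single]
      split_ifs with hkF
      · have hl : l = j := ((Finset.mem_filter.1 (hF hkF)).2).symm
        subst hl
        rw [hf F hF hkF]
        have := Finset.sum_le_sum_of_subset_of_nonneg hF fun e _ _ => hw.1 e
        linarith
      · rw [add_zero]; exact hw.2.2 l F hF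
    · by_cases hl : l = k
      · subst hl; rw [hd]; exact le_top
      · rw [Finset.sum_eq_zero]
        · simp
        · intro e he
          have : e ≠ (k, j) := by rintro rfl; exact hl (Finset.mem_filter.1 he).2.symm
          simp [hy, this]
  obtain ⟨z, hz, hzi, hzk⟩ := exists_of_mem_clinchingPolytope hw hξ hyR
  have h1 : z (k, j) = t := by
    have h2 : amount z k = z (k, j) := by
      rw [amount, Finset.sum_eq_single j]
      · intro l _ hl
        exact hz.2.1 _ fun h => hl (honly l h)
      · simp
    have h3 : amount y k = t := by
      simp [amount, hy, Pi.single_apply]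
    rw [← h2, hzk k hki, h3]
  refine le_antisymm ?_ (hξ.1 _)
  by_cases hE : (i, j) ∈ G.E
  · have hij : (i, j) ∈ (G.sellerEdges j).erase (k, j) := by
      refine Finset.mem_erase.2 ⟨fun h => hki ?_, Finset.mem_filter.2 ⟨hE, rfl⟩⟩
      exact (Prod.mk.inj h).1.symm
    have h2 := hz.2.2.1.2.2 j _ (subset_refl _)
    simp only [Pi.add_apply, Finset.sum_add_distrib] at h2
    rw [← Finset.add_sum_erase _ z hkj] at h2
    have h3 := Finset.single_le_sum (f := z) (fun e _ => hz.1 e) hij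
    rw [← hzi j]
    linarith
  · rw [← hzi j, hz.2.1 _ hE]

/-- Equality of polytopes is not visibly a closed condition on `ξ`. Splitting merged amounts turns
it into weak inequalities, as needed for compactness. -/
lemma clinchingPolytope_eq (hw : w ∈ G.polymatroid) :
    G.clinchingPolytope w d i = {ξ | (∀ e, 0 ≤ ξ e) ∧ (∀ e, e ∉ G.buyerEdges i → ξ e = 0) ∧
      ENNReal.ofReal (amount ξ i) ≤ d i ∧ ∀ y ∈ G.remnant w d, (∀ j, y (i, j) = 0) →
        ∀ F, ∑ c ∈ F, splitVec i ξ (amount y) c ≤ G.splitRank w i F} := by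
  ext ξ
  constructor
  · intro hξ
    refine ⟨hξ.1, hξ.2.1, ((mem_remnant_iff hw).1 (clinched_mem_remnant hw hξ)).2 i, ?_⟩
    intro y hy hyi F
    obtain ⟨z, hz, hzi, hzk⟩ := exists_of_mem_clinchingPolytope hw hξ hy
    refine le_trans (le_of_eq (Finset.sum_congr rfl fun c _ => ?_))
      ((splitVec_amount_mem (i := i) ((mem_remnant_iff hw).1 hz).1).2 F)
    rcases c with j | k
    · simp [splitVec, hzi]
    · by_cases hk : k = i <;> simp [splitVec, hk, hzk]
  · rintro ⟨h0, hE, hd, h⟩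
    refine mem_clinchingPolytope hw h0 hE fun y hy hyi => ?_
    have hyP := (mem_remnant_iff hw).1 hy
    obtain ⟨z, hz, hzi, hzk⟩ := exists_of_splitVec_mem (ξ := ξ) (a := amount y) (i := i) hw
      ⟨by
        rintro (j | k)
        · exact h0 _
        · exact (splitVec_amount_mem (i := i) hyP.1).1 (Sum.inr k), h y hy hyi⟩
    refine ⟨z, (mem_remnant_iff hw).2 ⟨hz, fun k => ?_⟩, hzi, hzk⟩
    by_cases hk : k = i
    · subst hk
      have : amount z k = amount ξ k := by simp [amount, hzi]
      rwa [this]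
    · rw [hzk k hk]; exact hyP.2 k

/-- The clinching polytope is compact, and a vector of largest total in it is maximal componentwise.
-/
lemma exists_maximal_clinched (hw : w ∈ G.polymatroid) :
    ∃ ξ, Maximal (fun ξ => ξ ∈ G.clinchingPolytope w d i) ξ := by
  have hcl : IsClosed (G.clinchingPolytope w d i) := by
    have hamt : Continuous fun ξ : N × M → ℝ => amount ξ i := by
      unfold amount; fun_prop
    have hsv : ∀ (a : N → ℝ) (F : Finset (M ⊕ N)),
        Continuous fun ξ : N × M → ℝ => ∑ c ∈ F, splitVec i ξ a c := by
      intro a F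
      refine continuous_finsetSum _ fun c _ => ?_
      rcases c with j | k
      · exact continuous_apply (i, j)
      · exact continuous_const
    rw [clinchingPolytope_eq hw]
    simp only [Set.ofPred_and, Set.ofPred_forall]
    refine IsClosed.inter (isClosed_iInter fun e => isClosed_le continuous_const
      (continuous_apply e)) (IsClosed.inter (isClosed_iInter fun e => isClosed_iInter fun _ =>
        isClosed_eq (continuous_apply e) continuous_const) (IsClosed.inter ?_ ?_))
    · exact isClosed_le (ENNReal.continuous_ofReal.comp hamt) continuous_const
    · exact isClosed_iInter fun y => isClosed_iInter fun _ => isClosed_iInter fun _ =>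
        isClosed_iInter fun F => isClosed_le (hsv _ F) continuous_const
  have hbd : G.clinchingPolytope w d i ⊆ Set.Icc 0 (fun _ => G.rank Finset.univ) := by
    intro ξ hξ
    refine ⟨hξ.1, fun e => ?_⟩
    have h1 := G.mem_polymatroid_iff.1 (clinched_mem_remnant hw hξ).2.2.1
    refine le_trans ?_ (h1.2 Finset.univ)
    refine le_trans ?_ (Finset.single_le_sum (fun e _ => h1.1 e) (Finset.mem_univ e))
    exact le_add_of_nonneg_left (hw.1 e)
  have hcomp : IsCompact (G.clinchingPolytope w d i) :=
    isCompact_Icc.of_isClosed_subset hcl hbd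
  have hne : (G.clinchingPolytope w d i).Nonempty := ⟨0, by simp, by simp, rfl⟩
  obtain ⟨ξ, hξ, hmax⟩ := hcomp.exists_isMaxOn hne
    (f := fun ξ : N × M → ℝ => ∑ e, ξ e) (by fun_prop)
  refine ⟨ξ, hξ, fun η hη hle e => ?_⟩
  by_contra hlt
  have := Finset.sum_lt_sum (s := Finset.univ) (fun e _ => hle e)
    ⟨e, Finset.mem_univ e, not_le.1 hlt⟩
  exact absurd (hmax hη) (not_le.2 this)

lemma exists_maximum_top (G : Market N M) :
    ∃ y ∈ G.remnant 0 (fun _ => ⊤), ∀ z ∈ G.remnant 0 (fun _ => ⊤), ∑ e, z e ≤ ∑ e, y e := by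
  have hr := G.rank_isPolymatroidRank
  have hpos : 0 ≤ G.rank Finset.univ := hr.empty ▸ hr.mono _ _ (Finset.empty_subset _)
  have h0 : (0 : N × M → ℝ) ∈ indepVectors G.rank := by
    refine ⟨by simp, fun F => ?_⟩
    simpa [hr.empty] using hr.mono ∅ F (Finset.empty_subset F)
  -- The cap exceeds the total rank, so no entry reaches it and the tight set is everything.
  obtain ⟨z, hz, -, -, T, hT, -, hoff⟩ := hr.exists_maximal_tight h0
    (b := fun _ => G.rank Finset.univ + 1) (fun _ => by simp only [Pi.zero_apply]; linarith)
  have hTu : T = Finset.univ := by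
    refine Finset.eq_univ_of_forall fun e => ?_
    by_contra he
    have h1 := Finset.single_le_sum (f := z) (fun e _ => hz.1 e) (Finset.mem_univ e)
    linarith [hz.2 Finset.univ, hoff e he]
  have hzP := G.mem_polymatroid_iff.2 hz
  refine ⟨z, ⟨hz.1, hzP.2.1, by simpa using hzP, fun _ => le_top⟩, fun y hy => ?_⟩
  rw [hTu] at hT
  rw [hT]
  have := hy.2.2.1
  rw [zero_add] at this
  exact (G.mem_polymatroid_iff.1 this).2 Finset.univ

end Market

/-! ### Effect of clinching on the state of the auction -/

namespace Auction

/-- Multiplying out the quotient also covers the clock `0`, where the demand is infinite and the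
product vanishes. -/
lemma ofReal_le_demand_iff {b p c x : ℝ} {B : ℝ≥0∞} (hx : 0 ≤ x) (hp : 0 ≤ p) (hc : 0 ≤ c)
    (hB : ENNReal.ofReal p ≤ B) :
    ENNReal.ofReal x ≤ demand b B p c ↔
      (b ≤ c ∧ x = 0) ∨ (c < b ∧ ENNReal.ofReal (p + c * x) ≤ B) := by
  unfold demand
  by_cases hbc : b ≤ c
  · rw [if_pos hbc, nonpos_iff_eq_zero, ENNReal.ofReal_eq_zero]
    simp only [hbc, true_and, not_lt.2 hbc, false_and, or_false]
    exact ⟨fun h => le_antisymm h hx, fun h => h.le⟩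
  · rw [if_neg hbc]
    simp only [hbc, false_and, false_or, not_le.1 hbc, true_and]
    split_ifs with h0
    · subst h0
      simpa using hB
    · have hc' : 0 < c := lt_of_le_of_ne hc (Ne.symm h0)
      rw [ENNReal.le_div_iff_mul_le (Or.inl (by simpa using hc')) (Or.inl ENNReal.ofReal_ne_top),
        ← ENNReal.ofReal_mul hx, ENNReal.ofReal_add hp (mul_nonneg hc hx), mul_comm x c]
      constructor
      · intro h
        calc _ ≤ ENNReal.ofReal p + (B - ENNReal.ofReal p) := by gcongr
          _ = B := add_tsub_cancel_of_le hB
      · exact fun h => ENNReal.le_sub_of_add_le_left ENNReal.ofReal_ne_top h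

section core

variable {N M : Type} [DecidableEq N] [DecidableEq M]

/-- Basic consistency of an auction state. -/
structure Valid (G : Market N M) (b : N → ℝ) (B : N → ℝ≥0∞) (s : AuctionState N M) : Prop where
  w_mem : s.w ∈ G.polymatroid
  p_nonneg : ∀ k, 0 ≤ s.p k
  c_nonneg : ∀ k, 0 ≤ s.c k
  p_le : ∀ k, ENNReal.ofReal (s.p k) ≤ B k
  d_eq : ∀ k, s.d k = demand (b k) (B k) (s.p k) (s.c k)

lemma Valid.le_d_iff {G : Market N M} {b : N → ℝ} {B : N → ℝ≥0∞} {s : AuctionState N M}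
    (hs : Valid G b B s) (k : N) {x : ℝ} (hx : 0 ≤ x) :
    ENNReal.ofReal x ≤ s.d k ↔
      (b k ≤ s.c k ∧ x = 0) ∨ (s.c k < b k ∧ ENNReal.ofReal (s.p k + s.c k * x) ≤ B k) := by
  rw [hs.d_eq k]
  exact ofReal_le_demand_iff hx (hs.p_nonneg k) (hs.c_nonneg k) (hs.p_le k)

lemma Valid.tick {G : Market N M} {b : N → ℝ} {B : N → ℝ≥0∞} {s t : AuctionState N M} {ε : ℝ} {k : N} (hs : Valid G b B s) (hε : 0 ≤ ε)
    (hw : t.w = s.w) (hp : t.p = s.p) (hc : t.c = Function.update s.c k (s.c k + ε))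
    (hd : t.d = Function.update s.d k (demand (b k) (B k) (s.p k) (s.c k + ε))) :
    Valid G b B t where
  w_mem := hw ▸ hs.w_mem
  p_nonneg := hp ▸ hs.p_nonneg
  p_le := hp ▸ hs.p_le
  c_nonneg := by
    intro l
    rw [hc]
    by_cases hl : l = k
    · subst hl; simpa using add_nonneg (hs.c_nonneg l) hε
    · simpa [hl] using hs.c_nonneg l
  d_eq := by
    intro l
    rw [hd, hc, hp]
    by_cases hl : l = k
    · subst hl; simp
    · simpa [hl] using hs.d_eq l

variable [Fintype N] [Fintype M]

/-- The data of a clinching step: the clinched vector and its effect on the state. -/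
structure ClinchStep (G : Market N M) (b : N → ℝ) (B : N → ℝ≥0∞) (i : N)
    (s t : AuctionState N M) (ξ : N × M → ℝ) : Prop where
  maximal : Maximal (fun ξ => ξ ∈ G.clinchingPolytope s.w s.d i) ξ
  w_eq : t.w = s.w + ξ
  c_eq : t.c = s.c
  l_eq : t.l = s.l
  p_of_ne : ∀ k, k ≠ i → t.p k = s.p k
  p_self : t.p i = s.p i + s.c i * amount ξ i
  d_of_ne : ∀ k, k ≠ i → t.d k = s.d k
  le_d_iff : ∀ x, 0 ≤ x → (ENNReal.ofReal x ≤ t.d i ↔ ENNReal.ofReal (x + amount ξ i) ≤ s.d i)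

variable {G : Market N M} {b : N → ℝ} {B : N → ℝ≥0∞} {i : N} {s t : AuctionState N M}

lemma ClinchOne.exists_step (hs : Valid G b B s) (h : ClinchOne G b B i s t) :
    Valid G b B t ∧ ∃ ξ, ClinchStep G b B i s t ξ := by
  obtain ⟨ξ, hξ, rfl⟩ := h
  have hξR := Market.clinched_mem_remnant hs.w_mem hξ.1
  have hξE := (Market.eq_zero_of_mem_clinchingPolytope hξ.1).1
  have hδ0 : 0 ≤ amount ξ i := amount_nonneg hξ.1.1 i
  have hδ : ENNReal.ofReal (amount ξ i) ≤ s.d i := ((Market.mem_remnant_iff hs.w_mem).1 hξR).2 i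
  rw [hs.le_d_iff i hδ0] at hδ
  have hp0 : 0 ≤ s.p i + s.c i * amount ξ i :=
    add_nonneg (hs.p_nonneg i) (mul_nonneg (hs.c_nonneg i) hδ0)
  have hpB : ENNReal.ofReal (s.p i + s.c i * amount ξ i) ≤ B i := by
    rcases hδ with ⟨-, h⟩ | ⟨-, h⟩
    · rw [h, mul_zero, add_zero]; exact hs.p_le i
    · exact h
  simp only [G.sum_buyerEdges hξE]
  refine ⟨⟨hξR.2.2.1, fun k => ?_, hs.c_nonneg, fun k => ?_, fun k => ?_⟩, ξ, hξ, rfl, rfl, rfl,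
    fun k hk => Function.update_of_ne hk _ _, Function.update_self _ _ _,
    fun k hk => Function.update_of_ne hk _ _, fun x hx => ?_⟩
  · by_cases hk : k = i
    · subst hk; simpa using hp0
    · simpa [hk] using hs.p_nonneg k
  · by_cases hk : k = i
    · subst hk; simpa using hpB
    · simpa [hk] using hs.p_le k
  · by_cases hk : k = i
    · subst hk; simp
    · simpa [hk] using hs.d_eq k
  · simp only [Function.update_self]
    rw [ofReal_le_demand_iff hx hp0 (hs.c_nonneg i) hpB, hs.le_d_iff i (add_nonneg hx hδ0)]
    have h1 : s.p i + s.c i * amount ξ i + s.c i * x = s.p i + s.c i * (x + amount ξ i) := by ring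
    rw [h1]
    rcases hδ with ⟨h2, h3⟩ | ⟨h2, h3⟩
    · rw [h3, add_zero]
    · simp [not_le.2 h2]

/-- `z` has maximal total amount among the vectors that can still be transacted. -/
def IsMaximum (G : Market N M) (s : AuctionState N M) (z : N × M → ℝ) : Prop :=
  z ∈ G.remnant s.w s.d ∧ ∀ x ∈ G.remnant s.w s.d, ∑ e, x e ≤ ∑ e, z e

variable {ξ : N × M → ℝ}

/-- The remnant polytope is translated by `ξ`, and a maximum gives `i` at least the clinched amount;
so the sellable total drops by exactly that amount. -/
lemma ClinchStep.exists_isMaximum (hs : Valid G b B s) (h : ClinchStep G b B i s t ξ)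
    {z : N × M → ℝ} (hz : IsMaximum G s z) :
    ∃ z', IsMaximum G t z' ∧ (∀ k, k ≠ i → amount z' k = amount z k) ∧
      ∑ e, z' e = ∑ e, z e - amount ξ i := by
  have hle := Market.amount_clinched_le hs.w_mem h.maximal.1 hz.1 hz.2
  obtain ⟨z', hz', hk, hi⟩ := Market.exists_remnant_after_clinch hs.w_mem h.maximal.1 h.d_of_ne
    h.le_d_iff hz.1
  rw [← h.w_eq] at hz'
  rw [max_eq_left (by linarith)] at hi
  have hsum : ∑ e, z' e = ∑ e, z e - amount ξ i := by
    rw [sum_sub_of_amount hk, hi]; ring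
  refine ⟨z', ⟨hz', fun x hx => ?_⟩, hk, hsum⟩
  rw [h.w_eq, Market.mem_remnant_add_iff h.maximal.1 h.d_of_ne h.le_d_iff hx.1] at hx
  have h1 := hz.2 _ hx
  simp only [Pi.add_apply, Finset.sum_add_distrib] at h1
  rw [Market.sum_eq_of_clinched h.maximal.1] at h1
  linarith

/-- The buyers other than `i` can absorb the whole remaining supply. -/
def Saturated (G : Market N M) (s : AuctionState N M) (i : N) : Prop :=
  ∃ z, IsMaximum G s z ∧ amount z i = 0

lemma ClinchStep.saturated_self (hs : Valid G b B s) (ht : Valid G b B t)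
    (h : ClinchStep G b B i s t ξ) : Saturated G t i := by
  obtain ⟨y, hy, hyi, hmax⟩ := Market.exists_maximum_without (d := t.d) (i := i) ht.w_mem (by
    rw [h.w_eq]
    exact Market.eq_zero_of_maximal_clinched hs.w_mem h.maximal h.d_of_ne h.le_d_iff)
  exact ⟨y, ⟨hy, hmax⟩, hyi⟩

lemma ClinchStep.saturated_of_ne (hs : Valid G b B s) (h : ClinchStep G b B i s t ξ) {k : N}
    (hk : k ≠ i) (hsat : Saturated G s k) : Saturated G t k := by
  obtain ⟨z, hz, hzk⟩ := hsat
  obtain ⟨z', hz', hk', -⟩ := h.exists_isMaximum hs hz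
  exact ⟨z', hz', by rw [hk' k hk, hzk]⟩

/-- A buyer is saturated once she has clinched and stays so while others clinch; a full pass thus
saturates everybody. `P` stands for any property that clinching preserves. -/
lemma ClinchList.spec {P : AuctionState N M → Prop}
    (hP : ∀ (i : N) (s t : AuctionState N M) (ξ : N × M → ℝ), Valid G b B s → Valid G b B t →
      ClinchStep G b B i s t ξ → P s → P t) :
    ∀ (is : List N) (s t : AuctionState N M), Valid G b B s → P s → ClinchList G b B is s t →
      Valid G b B t ∧ P t ∧ t.c = s.c ∧ t.l = s.l ∧
        ∀ k, (k ∈ is ∨ Saturated G s k) → Saturated G t k := by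
  intro is
  induction is with
  | nil =>
    rintro s t hs hPs rfl
    exact ⟨hs, hPs, rfl, rfl, by simp⟩
  | cons i is ih =>
    rintro s t hs hPs ⟨u, hu, hut⟩
    obtain ⟨huv, ξ, hξ⟩ := ClinchOne.exists_step hs hu
    obtain ⟨h1, h2, h3, h4, h5⟩ := ih u t huv (hP i s u ξ hs huv hξ hPs) hut
    refine ⟨h1, h2, h3.trans hξ.c_eq, h4.trans hξ.l_eq, fun k hk => h5 k ?_⟩
    by_cases hki : k = i
    · subst hki; exact Or.inr (hξ.saturated_self hs huv)
    · rcases hk with hk | hk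
      · exact Or.inl ((List.mem_cons.1 hk).resolve_left hki)
      · exact Or.inr (hξ.saturated_of_ne hs hki hk)

lemma ClinchList.exists (G : Market N M) (b : N → ℝ) (B : N → ℝ≥0∞) :
    ∀ (is : List N) (s : AuctionState N M), Valid G b B s → ∃ t, ClinchList G b B is s t := by
  intro is
  induction is with
  | nil => exact fun s _ => ⟨s, rfl⟩
  | cons i is ih =>
    intro s hs
    obtain ⟨ξ, hξ⟩ := Market.exists_maximal_clinched (d := s.d) (i := i) hs.w_mem
    have hone : ClinchOne G b B i s _ := ⟨ξ, hξ, rfl⟩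
    obtain ⟨t, ht⟩ := ih _ (ClinchOne.exists_step hs hone).1
    exact ⟨t, _, hone, ht⟩

/-! ### The potential -/

variable {S : Finset N} {μ κ Ψ q : ℝ}

/-- The potential of a state with respect to a vector `y` of future transactions, when a total of
`R` can still be sold: the buyers in `S` are accounted for by their payments, the other buyers by
their values. -/
def potential (b : N → ℝ) (S : Finset N) (μ κ q : ℝ) (s : AuctionState N M) (y : N × M → ℝ)
    (R : ℝ) : ℝ :=
  ∑ k, (if k ∈ S then κ * (s.p k + μ * amount y k) else b k * (amount y k + amount s.w k)) +
    q * (R - ∑ e, y e)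

/-- The potential of some affordable vector of future transactions is at least `Ψ`. -/
def PotentialGE (G : Market N M) (b : N → ℝ) (B : N → ℝ≥0∞) (S : Finset N) (μ κ Ψ q : ℝ)
    (s : AuctionState N M) : Prop :=
  ∃ y ∈ G.remnant s.w s.d, ∃ z, IsMaximum G s z ∧
    (∀ k, ENNReal.ofReal (s.p k + b k * amount y k) ≤ B k) ∧
    Ψ ≤ potential b S μ κ q s y (∑ e, z e)

lemma sum_le_sum_of_change {g h : N → ℝ} {i : N} {a : ℝ} (hne : ∀ k, k ≠ i → g k = h k)
    (hi : g i ≤ h i + a) : ∑ k, g k ≤ ∑ k, h k + a := by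
  rw [← Finset.add_sum_erase _ _ (Finset.mem_univ i),
    ← Finset.add_sum_erase _ h (Finset.mem_univ i),
    Finset.sum_congr rfl fun k hk => hne k (Finset.mem_erase.1 hk).1]
  linarith

/-- The part of `i` in `y` shrinks by the clinched amount, but not below zero. Units that were in
`y` leave a value term unchanged and raise a payment term by `κ (c - μ)` each. Units beyond `y` use
up idle supply, a loss of `q` each, which `b i` or `κ c` makes good. -/
lemma PotentialGE.clinch (hs : Valid G b B s) (ht : Valid G b B t)
    (h : ClinchStep G b B i s t ξ) (hκ : 0 ≤ κ)
    (hactive : s.c i < b i → q ≤ b i)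
    (hS : i ∈ S → 0 < amount ξ i → μ ≤ s.c i ∧ q ≤ κ * s.c i)
    (hΨ : PotentialGE G b B S μ κ Ψ q s) : PotentialGE G b B S μ κ Ψ q t := by
  obtain ⟨y, hy, z, hz, hyB, hle⟩ := hΨ
  obtain ⟨z', hz', -, hzsum⟩ := h.exists_isMaximum hs hz
  obtain ⟨y', hy', hyk, hyi⟩ := Market.exists_remnant_after_clinch hs.w_mem h.maximal.1 h.d_of_ne
    h.le_d_iff hy
  rw [← h.w_eq] at hy'
  have hδ0 : 0 ≤ amount ξ i := amount_nonneg h.maximal.1.1 i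
  have hyi0 : 0 ≤ amount y i := amount_nonneg hy.1 i
  have hξk : ∀ k, k ≠ i → amount ξ k = 0 := fun k hk => by
    simp [amount, (Market.eq_zero_of_mem_clinchingPolytope h.maximal.1).2 k hk]
  have hδd : ENNReal.ofReal (amount ξ i) ≤ s.d i := ((Market.mem_remnant_iff hs.w_mem).1
    (Market.clinched_mem_remnant hs.w_mem h.maximal.1)).2 i
  rw [hs.le_d_iff i hδ0] at hδd
  have hδc : 0 < amount ξ i → s.c i < b i := by
    intro h0
    rcases hδd with ⟨-, h1⟩ | ⟨h1, -⟩
    · exact absurd h1 h0.ne'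
    · exact h1
  refine ⟨y', hy', z', hz', fun k => ?_, hle.trans ?_⟩
  · by_cases hk : k = i
    · subst hk
      rw [hyi]
      rcases le_total (amount y k) (amount ξ k) with hcmp | hcmp
      · rw [max_eq_right (by linarith), mul_zero, add_zero]
        exact ht.p_le k
      · rw [max_eq_left (by linarith), h.p_self]
        refine le_trans (ENNReal.ofReal_le_ofReal ?_) (hyB k)
        rcases hδ0.eq_or_lt with h0 | h0
        · rw [← h0]; simp
        · nlinarith [hδc h0]
    · rw [h.p_of_ne k hk, hyk k hk]; exact hyB k
  · have hysum := sum_sub_of_amount hyk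
    unfold potential
    rw [hzsum, hysum]
    have hchange := sum_le_sum_of_change (i := i) (a := -(q * (amount y' i - amount y i + amount ξ i)))
      (g := fun k => if k ∈ S then κ * (s.p k + μ * amount y k) else
        b k * (amount y k + amount s.w k))
      (h := fun k => if k ∈ S then κ * (t.p k + μ * amount y' k) else
        b k * (amount y' k + amount t.w k)) (fun k hk => ?_) ?_
    · linarith
    · simp only [h.p_of_ne k hk, hyk k hk, h.w_eq, amount_add, hξk k hk, add_zero]
    · simp only [hyi, h.p_self, h.w_eq, amount_add]
      rcases le_total (amount y i) (amount ξ i) with hcmp | hcmp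
      · rw [max_eq_right (by linarith)]
        split_ifs with hiS
        · rcases hδ0.eq_or_lt with h0 | h0
          · have : amount y i = 0 := by linarith
            rw [← h0, this]; simp
          · obtain ⟨h1, h2⟩ := hS hiS h0
            nlinarith [mul_nonneg (sub_nonneg.2 h2) (sub_nonneg.2 hcmp),
              mul_nonneg (mul_nonneg hκ (sub_nonneg.2 h1)) hyi0]
        · rcases hδ0.eq_or_lt with h0 | h0
          · have : amount y i = 0 := by linarith
            rw [← h0, this]; simp
          · nlinarith [mul_nonneg (sub_nonneg.2 (hactive (hδc h0))) (sub_nonneg.2 hcmp)]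
      · rw [max_eq_left (by linarith)]
        split_ifs with hiS
        · rcases hδ0.eq_or_lt with h0 | h0
          · rw [← h0]; simp
          · nlinarith [mul_nonneg (mul_nonneg hκ (sub_nonneg.2 (hS hiS h0).1)) hδ0]
        · linarith

/-- The tick lowers only the demand of `k`, which `z` does not use. -/
lemma IsMaximum.tick {ε : ℝ} {k : N} (hs : Valid G b B s) (ht : Valid G b B t) (hε : 0 ≤ ε)
    (hw : t.w = s.w) (hp : t.p = s.p) (hc : t.c = Function.update s.c k (s.c k + ε))
    (hd : ∀ l, l ≠ k → t.d l = s.d l) {z : N × M → ℝ} (hz : IsMaximum G s z)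
    (hzk : amount z k = 0) : IsMaximum G t z := by
  have hck : t.c k = s.c k + ε := by rw [hc]; simp
  refine ⟨(Market.mem_remnant_iff ht.w_mem).2 ?_, fun x hx => hz.2 x ?_⟩
  · have hzP := (Market.mem_remnant_iff hs.w_mem).1 hz.1
    refine ⟨hw ▸ hzP.1, fun l => ?_⟩
    by_cases hl : l = k
    · subst hl; rw [hzk]; simp
    · rw [hd l hl]; exact hzP.2 l
  · have hxP := (Market.mem_remnant_iff ht.w_mem).1 hx
    refine (Market.mem_remnant_iff hs.w_mem).2 ⟨hw ▸ hxP.1, fun l => ?_⟩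
    by_cases hl : l = k
    · subst hl
      have hx0 := amount_nonneg hx.1 l
      have h1 := hxP.2 l
      rw [ht.le_d_iff l hx0, hck, hp] at h1
      rcases h1 with ⟨-, h1⟩ | ⟨h1, h2⟩
      · rw [h1]; simp
      · rw [hs.le_d_iff l hx0]
        refine Or.inr ⟨by linarith, (ENNReal.ofReal_le_ofReal ?_).trans h2⟩
        nlinarith
    · rw [← hd l hl]; exact hxP.2 l

/-- Saturation of `k` keeps the sellable total. If `k` drops out, her part of `y` becomes idle
supply at a price `q' ≥ s.c k + ε ≥ b k`. Otherwise `y` stays possible, being affordable even at the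
bids. -/
lemma PotentialGE.tick {ε q' : ℝ} {k : N} (hs : Valid G b B s) (ht : Valid G b B t) (hε : 0 ≤ ε)
    (hw : t.w = s.w) (hp : t.p = s.p) (hc : t.c = Function.update s.c k (s.c k + ε))
    (hd : ∀ l, l ≠ k → t.d l = s.d l)
    (hsat : Saturated G s k) (hq : q ≤ q') (hcq : s.c k + ε ≤ q') (hS : k ∈ S → κ * μ ≤ b k)
    (hΨ : PotentialGE G b B S μ κ Ψ q s) : PotentialGE G b B S μ κ Ψ q' t := by
  obtain ⟨y, hy, z₁, hz₁, hyB, hle⟩ := hΨ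
  obtain ⟨z, hz, hzk⟩ := hsat
  have hck : t.c k = s.c k + ε := by rw [hc]; simp
  have hyP := (Market.mem_remnant_iff hs.w_mem).1 hy
  have hz1z : ∑ e, z₁ e ≤ ∑ e, z e := hz.2 _ hz₁.1
  have hyz := hz.2 _ hy
  have hyk0 := amount_nonneg hy.1 k
  have hpot : Ψ ≤ potential b S μ κ q s y (∑ e, z e) + (q' - q) * (∑ e, z e - ∑ e, y e) := by
    have hzz : ∑ e, z₁ e = ∑ e, z e := le_antisymm hz1z (hz₁.2 _ hz.1)
    rw [hzz] at hle
    nlinarith [mul_nonneg (sub_nonneg.2 hq) (sub_nonneg.2 hyz)]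
  by_cases hdrop : b k ≤ s.c k + ε
  · set y' : N × M → ℝ := fun e => if e.1 = k then 0 else y e with hy'
    have hy's : y' ∈ G.remnant s.w s.d := by
      refine Market.remnant_of_le hs.w_mem hy (fun e => ?_) (fun e => ?_)
      · simp only [hy']; split_ifs <;> [rfl; exact hy.1 e]
      · simp only [hy']; split_ifs <;> [exact hy.1 e; rfl]
    have hne : ∀ l, l ≠ k → amount y' l = amount y l := by
      intro l hl
      simp [amount, hy', hl]
    have hk0 : amount y' k = 0 := by simp [amount, hy']
    have hsum := sum_sub_of_amount hne
    refine ⟨y', ?_, z, hz.tick hs ht hε hw hp hc hd hzk, fun l => ?_, hpot.trans ?_⟩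
    · have hP := (Market.mem_remnant_iff hs.w_mem).1 hy's
      refine (Market.mem_remnant_iff ht.w_mem).2 ⟨hw ▸ hP.1, fun l => ?_⟩
      by_cases hl : l = k
      · subst hl; rw [hk0]; simp
      · rw [hd l hl]; exact hP.2 l
    · by_cases hl : l = k
      · subst hl; rw [hk0, mul_zero, add_zero]; exact ht.p_le l
      · rw [hne l hl, hp]; exact hyB l
    · have hchange := sum_le_sum_of_change (i := k) (a := q' * amount y k)
        (g := fun k => if k ∈ S then κ * (s.p k + μ * amount y k) else
          b k * (amount y k + amount s.w k))
        (h := fun k => if k ∈ S then κ * (t.p k + μ * amount y' k) else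
          b k * (amount y' k + amount t.w k)) (fun l hl => by simp only [hne l hl, hp, hw]) (by
            simp only [hk0, hp, hw]
            split_ifs with hkS
            · nlinarith [mul_nonneg (sub_nonneg.2 ((hS hkS).trans (hdrop.trans hcq))) hyk0]
            · nlinarith [mul_nonneg (sub_nonneg.2 (hdrop.trans hcq)) hyk0])
      unfold potential
      rw [hsum, hk0]
      linarith
  · rw [not_le] at hdrop
    refine ⟨y, ?_, z, hz.tick hs ht hε hw hp hc hd hzk, fun l => hp ▸ hyB l, hpot.trans ?_⟩
    · refine (Market.mem_remnant_iff ht.w_mem).2 ⟨hw ▸ hyP.1, fun l => ?_⟩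
      by_cases hl : l = k
      · subst hl
        rw [ht.le_d_iff l hyk0, hck, hp]
        refine Or.inr ⟨hdrop, (ENNReal.ofReal_le_ofReal ?_).trans (hyB l)⟩
        nlinarith
      · rw [hd l hl]; exact hyP.2 l
    · unfold potential
      rw [hp, hw]
      linarith

end core
end Auction

/-! ### Loop invariant and termination -/

namespace Auction

variable {N M : Type} [Fintype N] [LinearOrder N] [Fintype M] [LinearOrder M]

lemma mem_order (k : N ⊕ M) : k ∈ order N M := by
  rcases k with i | j <;> simp [order]

lemma nodup_order : (order N M).Nodup := by
  unfold order
  refine List.nodup_append.2 ⟨(Finset.sort_nodup _ _).map Sum.inl_injective,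
    (Finset.sort_nodup _ _).map Sum.inr_injective, ?_⟩
  rintro a ha b hb rfl
  obtain ⟨i, -, rfl⟩ := List.mem_map.1 ha
  obtain ⟨j, -, h⟩ := List.mem_map.1 hb
  cases h

/-- The virtual buyers come after the original buyers. -/
lemma inl_mem_take_order {l : ℕ} {j : M} (h : Sum.inr j ∈ (order N M).take l) (i : N) :
    Sum.inl i ∈ (order N M).take l := by
  unfold order at h ⊢
  rw [List.take_append, List.mem_append] at h ⊢
  rcases h with h | h
  · obtain ⟨i, -, h⟩ := List.mem_map.1 (List.mem_of_mem_take h)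
    cases h
  · left
    rw [List.take_of_length_le]
    · simp
    · by_contra hlt
      rw [Nat.sub_eq_zero_of_le (by omega), List.take_zero] at h
      simp at h

/-- The bids in the extended market. -/
abbrev bids (v : N → ℝ) (ρ : M → ℝ) : N ⊕ M → ℝ := Sum.elim v ρ

/-- The budgets in the extended market. -/
abbrev budgets (M : Type) (B : N → ℝ) : N ⊕ M → ℝ≥0∞ :=
  Sum.elim (fun i => ENNReal.ofReal (B i)) fun _ => ⊤

/-- The bids are positive multiples of `ε` and at least `μ`; the buyers in `S` are original ones
with bids exceeding `μ`. -/
structure Setting (v : N → ℝ) (ρ : M → ℝ) (ε μ : ℝ) (S : Finset (N ⊕ M)) : Prop where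
  ε_pos : 0 < ε
  μ_pos : 0 < μ
  le_bids : ∀ k, μ ≤ bids v ρ k
  multiple : ∀ k, ∃ z : ℕ, bids v ρ k = z * ε
  of_mem : ∀ k ∈ S, ∃ i, k = Sum.inl i ∧ μ + ε ≤ v i

/-- The loop invariant of the auction: the clocks before position `l` show `(z + 1) * ε`, the others
show `z * ε`; only original buyers with bids above `μ` have bought; the potential is at least `Ψ`. -/
structure Invariant (G : Market N M) (v : N → ℝ) (ρ : M → ℝ) (B : N → ℝ) (ε μ : ℝ)
    (S : Finset (N ⊕ M)) (Ψ : ℝ) (z : ℕ) (s : AuctionState (N ⊕ M) M) : Prop where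
  valid : Valid G.withVirtual (bids v ρ) (budgets M B) s
  l_lt : s.l < (order N M).length
  clock_done : ∀ k ∈ (order N M).take s.l, s.c k = (z + 1) * ε
  clock_todo : ∀ k, k ∉ (order N M).take s.l → s.c k = z * ε
  lt_bid : ∀ i, 0 < amount s.w (Sum.inl i) → μ < v i
  potential_ge : PotentialGE G.withVirtual (bids v ρ) (budgets M B) S μ (1 + ε / μ) Ψ
    ((z + 1) * ε) s

variable {G : Market N M} {v : N → ℝ} {ρ : M → ℝ} {B : N → ℝ} {ε μ Ψ : ℝ} {S : Finset (N ⊕ M)}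
  {z : ℕ} {s t : AuctionState (N ⊕ M) M}

lemma Invariant.clock_ge (hset : Setting v ρ ε μ S) (h : Invariant G v ρ B ε μ S Ψ z s)
    (k : N ⊕ M) : z * ε ≤ s.c k := by
  by_cases hk : k ∈ (order N M).take s.l
  · rw [h.clock_done k hk]; nlinarith [hset.ε_pos]
  · rw [h.clock_todo k hk]

/-- In every round the virtual buyers tick after the original ones. -/
lemma Invariant.clock_virtual_le (hset : Setting v ρ ε μ S) (h : Invariant G v ρ B ε μ S Ψ z s)
    (i : N) (j : M) : s.c (Sum.inr j) ≤ s.c (Sum.inl i) := by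
  by_cases hj : Sum.inr j ∈ (order N M).take s.l
  · rw [h.clock_done _ hj, h.clock_done _ (inl_mem_take_order hj i)]
  · rw [h.clock_todo _ hj]; exact h.clock_ge hset _

/-- An original buyer only clinches at prices that are at least the smallest bid. -/
lemma Invariant.le_clock_of_clinch (hset : Setting v ρ ε μ S)
    (h : Invariant G v ρ B ε μ S Ψ z s) {i : N} {ξ : (N ⊕ M) × M → ℝ}
    (hξ : ClinchStep G.withVirtual (bids v ρ) (budgets M B) (Sum.inl i) s t ξ)
    (hpos : 0 < amount ξ (Sum.inl i)) : μ ≤ s.c (Sum.inl i) := by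
  by_contra hlt
  rw [not_le] at hlt
  refine hpos.ne' (Finset.sum_eq_zero fun j _ => ?_)
  have hvE : ∀ l, ((Sum.inr j, l) : (N ⊕ M) × M) ∈ G.withVirtual.E ↔ l = j := by
    intro l
    simp [Market.withVirtual, eq_comm]
  -- Below `ρ j ≥ μ` the virtual buyer of `j` has infinite demand and could take the whole supply of
  -- `j`.
  refine Market.clinched_eq_zero_of_top h.valid.w_mem hξ.maximal.1 (k := Sum.inr j) (by simp)
    ((hvE j).2 rfl) (fun l hl => (hvE l).1 hl) (fun F _ hF => ?_) ?_
  · have : ((Sum.inr j, j) : (N ⊕ M) × M) ∈ G.withVirtual.sellerEdges j :=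
      Finset.mem_filter.2 ⟨(hvE j).2 rfl, rfl⟩
    simp only [Market.withVirtual] at this ⊢
    rw [if_pos hF, if_pos this]
  · have h1 : s.c (Sum.inr j) < ρ j :=
      (h.clock_virtual_le hset i j).trans_lt (hlt.trans_le (hset.le_bids (Sum.inr j)))
    rw [h.valid.d_eq]
    simp only [bids, budgets, Sum.elim_inr]
    rw [demand, if_neg (not_le.2 h1), ENNReal.top_sub ENNReal.ofReal_ne_top,
      ENNReal.top_div_of_ne_top ENNReal.ofReal_ne_top, ite_self]

/-- Bids are multiples of `ε`, so a bid above `z * ε` is at least the next multiple. -/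
lemma Invariant.lt_bid_of_clock_lt (hset : Setting v ρ ε μ S)
    (h : Invariant G v ρ B ε μ S Ψ z s) {k : N ⊕ M} (hk : s.c k < bids v ρ k) :
    (z + 1) * ε ≤ bids v ρ k := by
  obtain ⟨n, hn⟩ := hset.multiple k
  have h1 := (h.clock_ge hset k).trans_lt hk
  rw [hn] at h1 ⊢
  have h2 : (z : ℝ) < n := lt_of_mul_lt_mul_right h1 hset.ε_pos.le
  have h3 : (z : ℝ) + 1 ≤ n := by exact_mod_cast h2
  exact mul_le_mul_of_nonneg_right h3 hset.ε_pos.le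

lemma Invariant.clinchStep (hset : Setting v ρ ε μ S) (h : Invariant G v ρ B ε μ S Ψ z s)
    {i : N ⊕ M} {ξ : (N ⊕ M) × M → ℝ} (ht : Valid G.withVirtual (bids v ρ) (budgets M B) t)
    (hξ : ClinchStep G.withVirtual (bids v ρ) (budgets M B) i s t ξ) :
    Invariant G v ρ B ε μ S Ψ z t where
  valid := ht
  l_lt := hξ.l_eq ▸ h.l_lt
  clock_done := by rw [hξ.l_eq, hξ.c_eq]; exact h.clock_done
  clock_todo := by rw [hξ.l_eq, hξ.c_eq]; exact h.clock_todo
  lt_bid := by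
    intro k hk
    rw [hξ.w_eq, amount_add] at hk
    by_cases hki : Sum.inl k = i
    · subst hki
      by_cases hpos : 0 < amount ξ (Sum.inl k)
      · refine (h.le_clock_of_clinch hset hξ hpos).trans_lt ?_
        have hd := ((Market.mem_remnant_iff h.valid.w_mem).1
          (Market.clinched_mem_remnant h.valid.w_mem hξ.maximal.1)).2 (Sum.inl k)
        rw [h.valid.le_d_iff _ hpos.le] at hd
        rcases hd with ⟨-, h0⟩ | ⟨h0, -⟩
        · exact absurd h0 hpos.ne'
        · exact h0
      · exact h.lt_bid k (by linarith)
    · have h0 : amount ξ (Sum.inl k) = 0 := by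
        simp [amount, (Market.eq_zero_of_mem_clinchingPolytope hξ.maximal.1).2 _ hki]
      exact h.lt_bid k (by linarith)
  potential_ge := by
    have hκ : 0 ≤ 1 + ε / μ := by
      have := div_pos hset.ε_pos hset.μ_pos
      linarith
    refine h.potential_ge.clinch h.valid ht hξ hκ (h.lt_bid_of_clock_lt hset) fun hiS hpos => ?_
    obtain ⟨k, rfl, -⟩ := hset.of_mem i hiS
    have hμ := h.le_clock_of_clinch hset hξ hpos
    refine ⟨hμ, ?_⟩
    -- The price `(z + 1) * ε` exceeds the clock by at most `ε`. The factor `1 + ε / μ` pays for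
    -- this, as the clock is at least `μ`.
    have h1 : ε ≤ ε / μ * s.c (Sum.inl k) := by
      rw [div_mul_eq_mul_div, le_div_iff₀ hset.μ_pos]
      exact mul_le_mul_of_nonneg_left hμ hset.ε_pos.le
    linarith [h.clock_ge hset (Sum.inl k)]

/-- The equation counts ticks, for termination. The price in the potential rises only when a round
is complete. -/
lemma Invariant.iteration (hset : Setting v ρ ε μ S) (h : Invariant G v ρ B ε μ S Ψ z s)
    (hst : Iteration G.withVirtual (bids v ρ) (budgets M B) ε (order N M) s t) :
    ∃ z', Invariant G v ρ B ε μ S Ψ z' t ∧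
      z' * (order N M).length + t.l = z * (order N M).length + s.l + 1 := by
  obtain ⟨-, u, hu, k, hk, rfl⟩ := hst
  obtain ⟨hval, hinv, hc, hl, hsat⟩ := ClinchList.spec (P := Invariant G v ρ B ε μ S Ψ z)
    (fun i s t ξ _ ht hξ hP => hP.clinchStep hset ht hξ) _ _ _ h.valid h hu
  rw [← hl]
  clear hc hl h hu
  set L := (order N M).length
  have hkL : (order N M)[u.l]'hinv.l_lt = k := by
    rw [List.getElem?_eq_getElem hinv.l_lt] at hk
    exact Option.some.inj hk
  have hknot : k ∉ (order N M).take u.l := by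
    intro hmem
    obtain ⟨m, hm, hmk⟩ := List.mem_take_iff_getElem.1 hmem
    rw [← hkL] at hmk
    have := (nodup_order (N := N) (M := M)).getElem_inj_iff.1 hmk
    omega
  have hck : u.c k = z * ε := hinv.clock_todo k hknot
  have htick := hval.tick (k := k) (t := { u with
          c := Function.update u.c k (u.c k + ε)
          d := Function.update u.d k (demand (bids v ρ k) (budgets M B k) (u.p k) (u.c k + ε))
          l := (u.l + 1) % L }) hset.ε_pos.le rfl rfl rfl rfl
  have hpot : ∀ q', (z + 1) * ε ≤ q' → PotentialGE G.withVirtual (bids v ρ) (budgets M B) S μ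
      (1 + ε / μ) Ψ q' { u with
          c := Function.update u.c k (u.c k + ε)
          d := Function.update u.d k (demand (bids v ρ k) (budgets M B k) (u.p k) (u.c k + ε))
          l := (u.l + 1) % L } := by
    intro q' hq'
    refine hinv.potential_ge.tick hval htick hset.ε_pos.le rfl rfl rfl
      (fun m hm => Function.update_of_ne hm _ _) (hsat k (Or.inl (mem_order k))) hq' ?_ ?_
    · rw [hck]; linarith
    · intro hkS
      obtain ⟨i, rfl, hi⟩ := hset.of_mem k hkS
      have : (1 + ε / μ) * μ = μ + ε := by
        rw [add_mul, one_mul, div_mul_cancel₀ _ hset.μ_pos.ne']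
      rw [this]; exact hi
  have hclock : ∀ m, m ∈ (order N M).take (u.l + 1) →
      Function.update u.c k (u.c k + ε) m = (z + 1) * ε := by
    intro m hm
    by_cases hmk : m = k
    · subst hmk; rw [Function.update_self, hck]; ring
    · rw [Function.update_of_ne hmk]
      refine hinv.clock_done m ?_
      rw [List.take_succ_eq_append_getElem hinv.l_lt, List.mem_append, hkL] at hm
      simpa [hmk] using hm
  have hlt := hinv.l_lt
  rcases Nat.lt_or_ge (u.l + 1) L with hwrap | hwrap
  · have hmod : (u.l + 1) % L = u.l + 1 := Nat.mod_eq_of_lt hwrap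
    refine ⟨z, ⟨htick, ?_, ?_, ?_, hinv.lt_bid, hpot _ le_rfl⟩, ?_⟩
    · simp only [hmod]; exact hwrap
    · simp only [hmod]; exact hclock
    · simp only [hmod]
      intro m hm
      rw [List.take_succ_eq_append_getElem hinv.l_lt, List.mem_append, hkL, not_or] at hm
      have hmk : m ≠ k := by simpa using hm.2
      rw [Function.update_of_ne hmk]
      exact hinv.clock_todo m hm.1
    · simp only [hmod]; ring
  · have hL : u.l + 1 = L := le_antisymm hlt hwrap
    have hmod : (u.l + 1) % L = 0 := by rw [hL, Nat.mod_self]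
    refine ⟨z + 1, ⟨htick, ?_, ?_, ?_, hinv.lt_bid, hpot _ ?_⟩, ?_⟩
    · simp only [hmod]; omega
    · simp [hmod]
    · simp only [hmod]
      intro m _
      push_cast
      refine hclock m ?_
      rw [hL, List.take_length]
      exact mem_order m
    · push_cast; nlinarith [hset.ε_pos]
    · simp only [hmod]
      rw [add_mul, one_mul, add_zero, add_assoc, hL]

lemma Invariant.of_reflTransGen (hset : Setting v ρ ε μ S)
    (h : Invariant G v ρ B ε μ S Ψ z s)
    (hst : Relation.ReflTransGen
      (Iteration G.withVirtual (bids v ρ) (budgets M B) ε (order N M)) s t) :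
    ∃ z', Invariant G v ρ B ε μ S Ψ z' t := by
  induction hst with
  | refl => exact ⟨z, h⟩
  | tail _ hstep ih =>
    obtain ⟨z', hz'⟩ := ih
    obtain ⟨z'', hz'', -⟩ := hz'.iteration hset hstep
    exact ⟨z'', hz''⟩

lemma valid_initial {N M : Type} [LinearOrder N] [Fintype M] [LinearOrder M] {G : Market N M}
    {v : N → ℝ} {ρ : M → ℝ} {B : N → ℝ} (hpos : ∀ k, 0 < bids v ρ k) :
    Valid G.withVirtual (bids v ρ) (budgets M B) (initial (N ⊕ M) M) where
  w_mem := by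
    rw [Market.mem_polymatroid_iff]
    refine ⟨fun _ => le_rfl, fun F => ?_⟩
    have := G.withVirtual.rank_isPolymatroidRank
    simpa [initial, this.empty] using this.mono ∅ F (Finset.empty_subset F)
  p_nonneg := fun _ => le_rfl
  c_nonneg := fun _ => le_rfl
  p_le := by simp [initial]
  d_eq := by
    intro k
    simp [initial, demand, hpos k]

/-- Nothing is paid yet, so a buyer of `S` contributes `κ μ = μ + ε` per unit; idle supply only
adds. -/
lemma invariant_initial [Nonempty (N ⊕ M)] (hset : Setting v ρ ε μ S) {y : (N ⊕ M) × M → ℝ}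
    (hy : y ∈ G.withVirtual.polymatroid)
    (hyB : ∀ i, v i * amount y (Sum.inl i) ≤ B i) :
    Invariant G v ρ B ε μ S (∑ k, if k ∈ S then (μ + ε) * amount y k else bids v ρ k * amount y k)
      0 (initial (N ⊕ M) M) where
  valid := valid_initial fun k => hset.μ_pos.trans_le (hset.le_bids k)
  l_lt := List.length_pos_of_mem (mem_order (Classical.arbitrary (N ⊕ M)))
  clock_done := by simp [initial]
  clock_todo := by simp [initial]
  lt_bid := by simp [initial, amount]
  potential_ge := by
    obtain ⟨z, hz, hmax⟩ := G.withVirtual.exists_maximum_top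
    have hyR : y ∈ G.withVirtual.remnant 0 (fun _ => ⊤) :=
      ⟨hy.1, hy.2.1, by rwa [zero_add], fun _ => le_top⟩
    refine ⟨y, hyR, z, ⟨hz, hmax⟩, ?_, ?_⟩
    · rintro (i | j)
      · simpa [initial] using ENNReal.ofReal_le_ofReal (hyB i)
      · exact le_top
    · have h1 : 0 ≤ ((0 : ℕ) + 1 : ℝ) * ε * (∑ e, z e - ∑ e, y e) := by
        refine mul_nonneg ?_ (sub_nonneg.2 (hmax y hyR))
        have := hset.ε_pos
        norm_num
        exact this.le
      unfold potential
      refine le_add_of_le_of_nonneg (Finset.sum_le_sum fun k _ => le_of_eq ?_) h1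
      have : (1 + ε / μ) * μ = μ + ε := by
        rw [add_mul, one_mul, div_mul_cancel₀ _ hset.μ_pos.ne']
      split_ifs
      · rw [← this]; simp [initial]; ring
      · simp [initial, amount]

lemma exists_iteration (hs : Invariant G v ρ B ε μ S Ψ z s) (hd : ∃ k, s.d k ≠ 0) :
    ∃ t, Iteration G.withVirtual (bids v ρ) (budgets M B) ε (order N M) s t := by
  obtain ⟨u, hu⟩ := ClinchList.exists G.withVirtual (bids v ρ) (budgets M B) (order N M) s hs.valid
  have hl : u.l = s.l := (ClinchList.spec (P := fun _ => True) (fun _ _ _ _ _ _ _ _ => trivial)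
    _ _ _ hs.valid trivial hu).2.2.2.1
  exact ⟨_, hd, u, hu, (order N M)[u.l]'(hl ▸ hs.l_lt), List.getElem?_eq_getElem _, rfl⟩

/-- Here `n` bounds the number of ticks after which all clocks have reached `K * ε`, hence all bids.
-/
lemma exists_terminal (hset : Setting v ρ ε μ S) {K : ℕ} (hK : ∀ k, bids v ρ k ≤ K * ε) :
    ∀ (n : ℕ) (z : ℕ) (s : AuctionState (N ⊕ M) M), Invariant G v ρ B ε μ S Ψ z s →
      K * (order N M).length ≤ z * (order N M).length + s.l + n →
      ∃ t, Relation.ReflTransGen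
        (Iteration G.withVirtual (bids v ρ) (budgets M B) ε (order N M)) s t ∧ ∀ k, t.d k = 0 := by
  intro n
  induction n with
  | zero =>
    intro z s hs hle
    refine ⟨s, Relation.ReflTransGen.refl, fun k => ?_⟩
    have hzK : K ≤ z := by
      by_contra hlt
      have h1 : (z + 1) * (order N M).length ≤ K * (order N M).length :=
        Nat.mul_le_mul_right _ (by omega)
      have := hs.l_lt
      rw [add_mul, one_mul] at h1
      omega
    have h2 : bids v ρ k ≤ s.c k := by
      refine (hK k).trans (le_trans ?_ (hs.clock_ge hset k))
      exact mul_le_mul_of_nonneg_right (by exact_mod_cast hzK) hset.ε_pos.le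
    rw [hs.valid.d_eq, demand, if_pos h2]
  | succ n ih =>
    intro z s hs hle
    by_cases hd : ∃ k, s.d k ≠ 0
    · obtain ⟨u, hu⟩ := exists_iteration hs hd
      obtain ⟨z', hz', hcount⟩ := hs.iteration hset hu
      obtain ⟨t, ht, h0⟩ := ih z' u hz' (by omega)
      exact ⟨t, Relation.ReflTransGen.head hu ht, h0⟩
    · push Not at hd
      exact ⟨s, Relation.ReflTransGen.refl, hd⟩

/-- For bids that are multiples of `ε`, a smallest bid. -/
lemma exists_setting {N M : Type} [Fintype N] [Fintype M] {v : N → ℝ} {ρ : M → ℝ} {ε : ℝ}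
    [Nonempty (N ⊕ M)] (hpos : ∀ k, 0 < bids v ρ k) (hε : 0 < ε)
    (hfit : FitsBids ε (bids v ρ)) :
    ∃ k₀, (∀ k, bids v ρ k₀ ≤ bids v ρ k) ∧
      ∀ S : Finset (N ⊕ M), (∀ k ∈ S, ∃ i, k = Sum.inl i ∧ bids v ρ k₀ < v i) →
        Setting v ρ ε (bids v ρ k₀) S := by
  obtain ⟨k₀, hk₀⟩ := Finite.exists_min (bids v ρ)
  refine ⟨k₀, hk₀, fun S hS => ⟨hε, hpos k₀, hk₀, hfit.1, fun k hk => ?_⟩⟩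
  obtain ⟨i, rfl, hi⟩ := hS k hk
  refine ⟨i, rfl, ?_⟩
  obtain ⟨n, hn⟩ := hfit.1 k₀
  obtain ⟨m, hm⟩ := hfit.1 (Sum.inl i)
  simp only [bids, Sum.elim_inl] at hm
  rw [bids] at hi ⊢
  rw [bids] at hn
  rw [hn, hm] at hi ⊢
  have h2 : (n : ℝ) < m := lt_of_mul_lt_mul_right hi hε.le
  have h3 : (n : ℝ) + 1 ≤ m := by exact_mod_cast h2
  nlinarith [mul_le_mul_of_nonneg_right h3 hε.le]

theorem exists_isPCAOutcome (hpos : ∀ k, 0 < bids v ρ k) (hε : 0 < ε) (hB : ∀ i, 0 ≤ B i)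
    (hfit : FitsBids ε (bids v ρ)) : ∃ A, IsPCAOutcome G v ρ B ε A := by
  suffices h : ∃ t, Relation.ReflTransGen (Iteration G.withVirtual (bids v ρ) (budgets M B) ε
      (order N M)) (initial (N ⊕ M) M) t ∧ ∀ k, t.d k = 0 by
    obtain ⟨t, ht, h0⟩ := h
    exact ⟨_, t, ht, h0, rfl⟩
  rcases isEmpty_or_nonempty (N ⊕ M) with hem | hne
  · exact ⟨_, Relation.ReflTransGen.refl, fun k => hem.elim k⟩
  · obtain ⟨k₀, -, hset⟩ := exists_setting hpos hε hfit
    -- With `S = ∅` and zero transactions the potential bound is void; only the clocks matter here.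
    have hset := hset ∅ (by simp)
    have hw := (valid_initial (G := G) (B := B) hpos).w_mem
    have hinv := invariant_initial hset hw (B := B) (by simpa [initial, amount] using hB)
    choose K hK using hfit.1
    refine exists_terminal hset (K := Finset.univ.sup K) (fun k => ?_) _ _ _ hinv (Nat.le_add_left _ _)
    rw [hK k]
    refine mul_le_mul_of_nonneg_right ?_ hε.le
    exact_mod_cast Finset.le_sup (f := K) (Finset.mem_univ k)

end Auction

/-! ### Virtual buyers and submarkets -/

/-- The amount of goods that seller `j` sells in `y`. -/
def supply {N M : Type} [Fintype N] (y : N × M → ℝ) (j : M) : ℝ := ∑ i, y (i, j)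

namespace Market

lemma sum_sellerEdges {N M : Type} [DecidableEq N] [DecidableEq M] [Fintype N] (G : Market N M)
    {y : N × M → ℝ} (hy : ∀ e, e ∉ G.E → y e = 0) (j : M) :
    ∑ e ∈ G.sellerEdges j, y e = supply y j := by
  have h : ∑ e ∈ G.sellerEdges j, y e =
      ∑ e ∈ Finset.univ.map ⟨fun i : N => (i, j), fun a b h => (Prod.mk.inj h).1⟩, y e := by
    refine Finset.sum_subset (fun e => ?_) (fun e he hne => hy e fun hE => hne ?_)
    · simp only [sellerEdges, Finset.mem_filter, Finset.mem_map, Finset.mem_univ, true_and]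
      rintro ⟨-, rfl⟩
      exact ⟨e.1, rfl⟩
    · obtain ⟨i, -, rfl⟩ := Finset.mem_map.1 he
      exact Finset.mem_filter.2 ⟨hE, rfl⟩
  rw [h, Finset.sum_map]
  rfl

lemma liquidWelfare_eq {N M : Type} [DecidableEq N] [DecidableEq M] [Fintype N] [Fintype M]
    (G : Market N M) (v B : N → ℝ) (ρ : M → ℝ) {A : Allocation N M}
    (hA : ∀ e, e ∉ G.E → A.w e = 0) :
    G.liquidWelfare v B ρ A = ∑ i, min (v i * amount A.w i) (B i) +
      ∑ j, ρ j * (G.f j (G.sellerEdges j) - supply A.w j) := by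
  simp only [liquidWelfare, G.sum_buyerEdges hA, G.sum_sellerEdges hA]

lemma supply_le {N M : Type} [DecidableEq N] [DecidableEq M] [Fintype N]
    {G : Market N M} {w : N × M → ℝ} (hw : w ∈ G.polymatroid) (j : M) :
    supply w j ≤ G.f j (G.sellerEdges j) := by
  rw [← G.sum_sellerEdges hw.2.1]
  exact hw.2.2 j _ (subset_refl _)

section withVirtual

variable {N M : Type} [DecidableEq N] [DecidableEq M] [Fintype M] {G : Market N M}

lemma inl_mem_withVirtual {i : N} {j : M} :
    ((Sum.inl i, j) : (N ⊕ M) × M) ∈ G.withVirtual.E ↔ (i, j) ∈ G.E := by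
  simp [withVirtual]

lemma inr_mem_withVirtual {j l : M} :
    ((Sum.inr j, l) : (N ⊕ M) × M) ∈ G.withVirtual.E ↔ l = j := by
  simp [withVirtual, eq_comm]

lemma withVirtual_f_sellerEdges (j : M) :
    G.withVirtual.f j (G.withVirtual.sellerEdges j) = G.f j (G.sellerEdges j) := by
  have h : ((Sum.inr j, j) : (N ⊕ M) × M) ∈ G.withVirtual.sellerEdges j :=
    Finset.mem_filter.2 ⟨inr_mem_withVirtual.2 rfl, rfl⟩
  simp only [withVirtual] at h ⊢
  rw [if_pos h]

lemma sum_withVirtual (j : M) {F : Finset ((N ⊕ M) × M)} (hF : F ⊆ G.withVirtual.sellerEdges j)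
    (y : (N ⊕ M) × M → ℝ) :
    ∑ e ∈ F, y e = ∑ e ∈ (G.sellerEdges j).filter (fun e => (Sum.inl e.1, e.2) ∈ F),
      y (Sum.inl e.1, e.2) + if (Sum.inr j, j) ∈ F then y (Sum.inr j, j) else 0 := by
  have hinj : Function.Injective (fun e : N × M => ((Sum.inl e.1, e.2) : (N ⊕ M) × M)) := by
    rintro ⟨a, b⟩ ⟨c, d⟩ h
    simpa using h
  rw [← Finset.sum_filter_add_sum_filter_not F (fun e => e = (Sum.inr j, j)), add_comm]
  congr 1
  · rw [← Finset.sum_image (f := y) (g := fun e : N × M => ((Sum.inl e.1, e.2) : (N ⊕ M) × M))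
      fun _ _ _ _ h => hinj h]
    refine Finset.sum_congr ?_ fun _ _ => rfl
    ext ⟨k, l⟩
    simp only [Finset.mem_filter, Finset.mem_image, Prod.exists]
    constructor
    · rintro ⟨hk, hne⟩
      obtain ⟨hE, hl⟩ := Finset.mem_filter.1 (hF hk)
      simp only at hl
      subst hl
      rcases k with i | j'
      · exact ⟨i, l, ⟨Finset.mem_filter.2 ⟨inl_mem_withVirtual.1 hE, rfl⟩, hk⟩, rfl⟩
      · exact absurd (by rw [inr_mem_withVirtual.1 hE]) hne
    · rintro ⟨i, l', ⟨-, h⟩, heq⟩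
      rw [← heq]
      exact ⟨h, by simp⟩
  · rw [Finset.filter_eq']
    split_ifs <;> simp

variable [Fintype N]

/-- Goods of a virtual buyer are unsold, but unsold goods need not have been clinched by her; hence
only an inequality. -/
lemma of_withVirtual {w : (N ⊕ M) × M → ℝ} (hw : w ∈ G.withVirtual.polymatroid) :
    (fun e : N × M => w (Sum.inl e.1, e.2)) ∈ G.polymatroid ∧
      ∀ j, amount w (Sum.inr j) ≤
        G.f j (G.sellerEdges j) - supply (fun e : N × M => w (Sum.inl e.1, e.2)) j := by
  have hE : ∀ e : N × M, e ∉ G.E → w (Sum.inl e.1, e.2) = 0 := fun e he =>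
    hw.2.1 _ fun h => he (inl_mem_withVirtual.1 h)
  refine ⟨⟨fun e => hw.1 _, hE, fun j F hF => ?_⟩, fun j => ?_⟩
  · set F' : Finset ((N ⊕ M) × M) := F.image (fun e => (Sum.inl e.1, e.2)) with hF'
    have hmem : ∀ e : N × M, ((Sum.inl e.1, e.2) : (N ⊕ M) × M) ∈ F' ↔ e ∈ F := by
      rintro ⟨a, b⟩
      simp [hF']
    have hsub : F' ⊆ G.withVirtual.sellerEdges j := by
      intro e he
      obtain ⟨e, he', rfl⟩ := Finset.mem_image.1 he
      obtain ⟨h1, h2⟩ := Finset.mem_filter.1 (hF he')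
      exact Finset.mem_filter.2 ⟨inl_mem_withVirtual.2 h1, h2⟩
    have hnot : ((Sum.inr j, j) : (N ⊕ M) × M) ∉ F' := by simp [hF']
    have hfil : (G.sellerEdges j).filter
        (fun e => ((Sum.inl e.1, e.2) : (N ⊕ M) × M) ∈ F') = F := by
      ext e
      rw [Finset.mem_filter, hmem]
      exact ⟨fun h => h.2, fun h => ⟨hF h, h⟩⟩
    have h := hw.2.2 j F' hsub
    rw [sum_withVirtual j hsub, if_neg hnot, hfil, add_zero] at h
    refine h.trans (le_of_eq ?_)
    simp only [withVirtual]
    rw [if_neg hnot, hfil]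
  · have h1 := supply_le hw j
    rw [withVirtual_f_sellerEdges, supply, Fintype.sum_sum_type] at h1
    have h2 : ∑ l, w (Sum.inr l, j) = amount w (Sum.inr j) := by
      rw [amount, Finset.sum_eq_single j, Finset.sum_eq_single j]
      · intro l _ hl
        exact hw.2.1 _ fun h => hl (inr_mem_withVirtual.1 h)
      · simp
      · intro l _ hl
        exact hw.2.1 _ fun h => hl (inr_mem_withVirtual.1 h).symm
      · simp
    rw [h2] at h1
    unfold supply
    linarith

/-- Scale down the transactions of the buyers and let the virtual buyers take what is unsold. -/
lemma exists_withVirtual {x : N × M → ℝ} (hx : x ∈ G.polymatroid) {θ : N → ℝ}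
    (h0 : ∀ i, 0 ≤ θ i) (h1 : ∀ i, θ i ≤ 1) :
    ∃ y ∈ G.withVirtual.polymatroid, (∀ i, amount y (Sum.inl i) = θ i * amount x i) ∧
      ∀ j, amount y (Sum.inr j) = G.f j (G.sellerEdges j) - supply x j := by
  set y : (N ⊕ M) × M → ℝ := fun e => Sum.elim (fun i => θ i * x (i, e.2))
    (fun j => if e.2 = j then G.f j (G.sellerEdges j) - supply x j else 0) e.1 with hy
  refine ⟨y, ⟨?_, ?_, fun j F hF => ?_⟩, fun i => ?_, fun j => ?_⟩
  · rintro ⟨i | j, l⟩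
    · exact mul_nonneg (h0 i) (hx.1 _)
    · simp only [hy, Sum.elim_inr]
      split_ifs
      · exact sub_nonneg.2 (supply_le hx j)
      · exact le_rfl
  · rintro ⟨i | j, l⟩ he
    · rw [inl_mem_withVirtual] at he
      simp [hy, hx.2.1 _ he]
    · rw [inr_mem_withVirtual] at he
      simp [hy, he]
  · have hle : ∀ T : Finset (N × M), ∑ e ∈ T, y (Sum.inl e.1, e.2) ≤ ∑ e ∈ T, x e := fun T =>
      Finset.sum_le_sum fun e _ => mul_le_of_le_one_left (hx.1 e) (h1 e.1)
    rw [sum_withVirtual j hF]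
    simp only [withVirtual]
    split_ifs with h
    · have h2 := (hle ((G.sellerEdges j).filter (fun e => (Sum.inl e.1, e.2) ∈ F))).trans
        (Finset.sum_le_sum_of_subset_of_nonneg (Finset.filter_subset _ _) fun e _ _ => hx.1 e)
      rw [G.sum_sellerEdges hx.2.1] at h2
      have h3 : y (Sum.inr j, j) = G.f j (G.sellerEdges j) - supply x j := by simp [hy]
      rw [h3]; linarith
    · rw [add_zero]
      exact (hle _).trans (hx.2.2 j _ (Finset.filter_subset _ _))
  · simp [amount, hy, Finset.mul_sum]
  · simp [amount, hy]

end withVirtual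

section restrict

variable {N M : Type} [DecidableEq N] [DecidableEq M] [Fintype N] {G : Market N M}
  {S : Finset M}

lemma mem_restrict {i : N} {j : {j // j ∈ S}} : (i, j) ∈ (G.restrict S).E ↔ (i, (j : M)) ∈ G.E := by
  simp [restrict]

lemma restrict_f_sellerEdges (j : {j // j ∈ S}) :
    (G.restrict S).f j ((G.restrict S).sellerEdges j) = G.f j (G.sellerEdges j) := by
  have : ((G.restrict S).sellerEdges j).image (fun e => (e.1, (e.2 : M))) = G.sellerEdges j := by
    ext ⟨i, l⟩
    simp only [sellerEdges, Finset.mem_image, Finset.mem_filter, Prod.exists, Prod.mk.injEq]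
    constructor
    · rintro ⟨a, b, ⟨h1, rfl⟩, rfl, rfl⟩
      exact ⟨mem_restrict.1 h1, rfl⟩
    · rintro ⟨h1, rfl⟩
      exact ⟨i, j, ⟨mem_restrict.2 h1, rfl⟩, rfl, rfl⟩
  exact congrArg (G.f j) this

lemma restrict_mem_polymatroid {x : N × M → ℝ} (hx : x ∈ G.polymatroid) :
    (fun e : N × {j // j ∈ S} => x (e.1, (e.2 : M))) ∈ (G.restrict S).polymatroid := by
  refine ⟨fun e => hx.1 _, fun e he => hx.2.1 _ fun h => he (mem_restrict.2 h), fun j F hF => ?_⟩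
  have hinj : Function.Injective (fun e : N × {j // j ∈ S} => (e.1, (e.2 : M))) := by
    rintro ⟨a, b⟩ ⟨c, d⟩ h
    simp only [Prod.mk.injEq] at h
    exact Prod.ext h.1 (Subtype.ext h.2)
  rw [← Finset.sum_image (f := x) (g := fun e : N × {j // j ∈ S} => (e.1, (e.2 : M)))
    fun _ _ _ _ h => hinj h]
  refine hx.2.2 j _ fun e he => ?_
  obtain ⟨e, he', rfl⟩ := Finset.mem_image.1 he
  obtain ⟨h1, h2⟩ := Finset.mem_filter.1 (hF he')
  exact Finset.mem_filter.2 ⟨mem_restrict.1 h1, congrArg Subtype.val h2⟩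

end restrict

end Market

/-! ### The auction is half-optimal at its bids -/

namespace Auction

section halfOptimal

variable {N M : Type} [Fintype N] [LinearOrder N] [Fintype M] [LinearOrder M]
  {G : Market N M} {v : N → ℝ} {ρ : M → ℝ} {B : N → ℝ} {ε : ℝ}

/-- The bound on `ε` gives `v - (μ + ε) ≤ (1 - ε / μ) * v`, so the two terms are at most `(1 - ε /
μ) * B` and `(1 + ε / μ) * B`. -/
lemma exhausted_bound {μ v B p y : ℝ} (hμ : 0 < μ) (hε : 0 < ε) (hv : μ + ε ≤ v)
    (hfit : ε * (v - μ) ≤ μ ^ 2) (hy : v * y ≤ B) (hy0 : 0 ≤ y) (hp : p ≤ B) :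
    (v - (μ + ε)) * y + (1 + ε / μ) * p ≤ 2 * B := by
  have hεμ : ε ≤ μ := by nlinarith
  have h1 : 0 ≤ 1 - ε / μ := sub_nonneg.2 ((div_le_one hμ).2 hεμ)
  have h2 : 0 ≤ 1 + ε / μ := by linarith [div_pos hε hμ]
  have h3 : v - (μ + ε) ≤ (1 - ε / μ) * v := by
    have : ε / μ * v ≤ μ + ε := by
      rw [div_mul_eq_mul_div, div_le_iff₀ hμ]
      nlinarith
    linarith
  have h4 := mul_le_mul_of_nonneg_right h3 hy0
  have h5 := mul_le_mul_of_nonneg_left hy h1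
  have h6 := mul_le_mul_of_nonneg_left hp h2
  nlinarith

/-- The outcomes of the Polyhedral Clinching Auction have at least half of the optimal liquid
welfare. -/
theorem IsPCAOutcome.half_optimal (hpos : ∀ k, 0 < bids v ρ k) (hε : 0 < ε) (hB : ∀ i, 0 ≤ B i)
    (hfit : FitsBids ε (bids v ρ)) {A : Allocation N M} (hA : IsPCAOutcome G v ρ B ε A) :
    A.w ∈ G.polymatroid ∧ ∀ x ∈ G.polymatroid,
      ∑ i, min (v i * amount x i) (B i) + ∑ j, ρ j * (G.f j (G.sellerEdges j) - supply x j) ≤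
        2 * (∑ i, min (v i * amount A.w i) (B i) +
          ∑ j, ρ j * (G.f j (G.sellerEdges j) - supply A.w j)) := by
  obtain ⟨s, hs, hd, rfl⟩ := hA
  rcases isEmpty_or_nonempty (N ⊕ M) with hem | hne
  · obtain ⟨hN, hM⟩ := isEmpty_sum.1 hem
    refine ⟨⟨fun e => hM.elim e.2, fun e => hM.elim e.2, fun j => hM.elim j⟩, fun x _ => ?_⟩
    simp
  obtain ⟨k₀, hk₀, hset⟩ := exists_setting hpos hε hfit
  set μ := bids v ρ k₀ with hμ
  -- The set `S` depends on the final state. A first pass with `S = ∅` shows that whoever has bought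
  -- bids more than `μ`; the same run is then followed again with `S`.
  have hinv₀ := invariant_initial (G := G) (B := B) (hset ∅ (by simp))
    (valid_initial (G := G) (B := B) hpos).w_mem (by simpa [initial, amount] using hB)
  obtain ⟨z₀, hz₀⟩ := hinv₀.of_reflTransGen (hset ∅ (by simp)) hs
  obtain ⟨hwmem, hwr⟩ := Market.of_withVirtual hz₀.valid.w_mem
  refine ⟨hwmem, fun x hx => ?_⟩
  have hw0 : ∀ k, 0 ≤ amount s.w k := amount_nonneg hz₀.valid.w_mem.1
  have hx0 : ∀ i, 0 ≤ amount x i := amount_nonneg hx.1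
  have hv : ∀ i, 0 < v i := fun i => hpos (Sum.inl i)
  -- Buyers whose liquid welfare is the budget. Those who bought nothing are left out, as their bids
  -- may equal `μ`.
  set S : Finset (N ⊕ M) := (Finset.univ.filter (fun i : N =>
    0 < amount s.w (Sum.inl i) ∧ B i ≤ v i * amount s.w (Sum.inl i))).image Sum.inl with hS
  have hSl : ∀ i, Sum.inl i ∈ S ↔
      0 < amount s.w (Sum.inl i) ∧ B i ≤ v i * amount s.w (Sum.inl i) := by
    intro i; simp [hS]
  have hSr : ∀ j : M, Sum.inr j ∉ S := by intro j; simp [hS]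
  have hsetS := hset S (by
    intro k hk
    obtain ⟨i, hi, rfl⟩ := Finset.mem_image.1 hk
    exact ⟨i, rfl, hz₀.lt_bid i (Finset.mem_filter.1 hi).2.1⟩)
  -- Scaling the value down to the budget keeps the liquid welfare of the buyer.
  set θ : N → ℝ := fun i => if v i * amount x i ≤ B i then 1 else B i / (v i * amount x i) with hθ
  have hθ0 : ∀ i, 0 ≤ θ i := by
    intro i
    simp only [hθ]
    split_ifs
    · exact zero_le_one
    · exact div_nonneg (hB i) (mul_nonneg (hv i).le (hx0 i))
  have hθ1 : ∀ i, θ i ≤ 1 := by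
    intro i
    simp only [hθ]
    split_ifs with h
    · exact le_rfl
    · exact div_le_one_of_le₀ (not_le.1 h).le (mul_nonneg (hv i).le (hx0 i))
  have hθx : ∀ i, v i * (θ i * amount x i) = min (v i * amount x i) (B i) := by
    intro i
    simp only [hθ]
    split_ifs with h
    · rw [min_eq_left h, one_mul]
    · have hne : v i * amount x i ≠ 0 := by
        have := (hB i).trans_lt (not_le.1 h)
        exact this.ne'
      rw [min_eq_right (not_le.1 h).le, mul_left_comm, div_mul_cancel₀ _ hne]
  obtain ⟨y, hy, hyl, hyr⟩ := Market.exists_withVirtual hx hθ0 hθ1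
  have hinv := invariant_initial (B := B) hsetS hy (by
    intro i
    rw [hyl, hθx]
    exact min_le_right _ _)
  obtain ⟨z, hz⟩ := hinv.of_reflTransGen hsetS hs
  obtain ⟨y', hy', z', hz', -, hΨ⟩ := hz.potential_ge
  -- All demands are zero at the end, so neither `y'` nor idle supply contributes to the final
  -- potential.
  have hzero : ∀ u ∈ G.withVirtual.remnant s.w s.d, ∀ k, amount u k = 0 := by
    intro u hu k
    have h1 := ((Market.mem_remnant_iff hz.valid.w_mem).1 hu).2 k
    rw [hd k, nonpos_iff_eq_zero, ENNReal.ofReal_eq_zero] at h1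
    exact le_antisymm h1 (amount_nonneg hu.1 k)
  have hsum : ∀ u ∈ G.withVirtual.remnant s.w s.d, ∑ e, u e = 0 := by
    intro u hu
    rw [← sum_amount]
    exact Finset.sum_eq_zero fun k _ => hzero u hu k
  unfold potential at hΨ
  rw [hsum y' hy', hsum z' hz'.1] at hΨ
  simp only [hzero y' hy', mul_zero, add_zero, zero_add, sub_zero, Fintype.sum_sum_type, hSr,
    if_false, bids, Sum.elim_inl, Sum.elim_inr] at hΨ
  have hl : ∀ i, min (v i * amount x i) (B i) -
      (if Sum.inl i ∈ S then (μ + ε) * amount y (Sum.inl i) else v i * amount y (Sum.inl i)) +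
      (if Sum.inl i ∈ S then (1 + ε / μ) * s.p (Sum.inl i) else v i * amount s.w (Sum.inl i)) ≤
      2 * min (v i * amount s.w (Sum.inl i)) (B i) := by
    intro i
    rw [← hθx, ← hyl]
    split_ifs with hi
    · have hi' := (hSl i).1 hi
      have hp : s.p (Sum.inl i) ≤ B i :=
        (ENNReal.ofReal_le_ofReal_iff (hB i)).1 (hz.valid.p_le (Sum.inl i))
      obtain ⟨i', hii, hvi⟩ := hsetS.of_mem _ hi
      obtain rfl := Sum.inl_injective hii
      rw [min_eq_right hi'.2]
      have := exhausted_bound hsetS.μ_pos hε hvi (hfit.2 (Sum.inl i) k₀)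
        (y := amount y (Sum.inl i)) (by
          rw [hyl, hθx]
          exact min_le_right _ _) (amount_nonneg hy.1 _) hp
      linarith
    · rw [hSl, not_and] at hi
      have h2 : v i * amount s.w (Sum.inl i) ≤ min (v i * amount s.w (Sum.inl i)) (B i) := by
        rcases (hw0 (Sum.inl i)).eq_or_lt with h0 | h0
        · rw [← h0, mul_zero, min_eq_left (hB i)]
        · rw [min_eq_left (not_le.1 (hi h0)).le]
      have h3 := mul_nonneg (hv i).le (hw0 (Sum.inl i))
      linarith
  have hlsum := Finset.sum_le_sum fun i (_ : i ∈ Finset.univ) => hl i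
  rw [Finset.sum_add_distrib, Finset.sum_sub_distrib, ← Finset.mul_sum] at hlsum
  simp only [hyr] at hΨ
  have hr : ∑ j, ρ j * amount s.w (Sum.inr j) ≤ ∑ j, ρ j * (G.f j (G.sellerEdges j) -
      supply (fun e : N × M => s.w (Sum.inl e.1, e.2)) j) :=
    Finset.sum_le_sum fun j _ => mul_le_mul_of_nonneg_left (hwr j) (hpos (Sum.inr j)).le
  have hr0 : 0 ≤ ∑ j, ρ j * amount s.w (Sum.inr j) :=
    Finset.sum_nonneg fun j _ => mul_nonneg (hpos (Sum.inr j)).le (hw0 _)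
  have hamt : ∀ i, amount (fun e : N × M => s.w (Sum.inl e.1, e.2)) i = amount s.w (Sum.inl i) :=
    fun _ => rfl
  simp only [hamt]
  linarith

end halfOptimal

/-! ### The single-sample mechanism -/

section singleSample

variable {N M : Type} [Fintype N] [LinearOrder N] [Fintype M] [LinearOrder M]
  {G : Market N M} {v B : N → ℝ} {ρ ρs : M → ℝ} {ε : ℝ}

theorem exists_isSingleSampleOutcome (hv : ∀ i, 0 < v i) (hB : ∀ i, 0 ≤ B i)
    (hρs : ∀ j, 0 < ρs j) (hε : 0 < ε)
    (hfit : FitsBids ε (Sum.elim v (participantSamples ρ ρs))) :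
    ∃ A, IsSingleSampleOutcome G v ρ ρs B ε A := by
  obtain ⟨A', hA'⟩ := exists_isPCAOutcome (G := G.restrict (participants ρ ρs)) (B := B)
    (by rintro (i | j) <;> [exact hv i; exact hρs j]) hε hB hfit
  exact ⟨_, A', hA', rfl⟩

/-- The outcomes of the single-sample mechanism have at least half of the optimal liquid welfare
among the participants, measured at the samples. -/
theorem IsSingleSampleOutcome.half_optimal (hv : ∀ i, 0 < v i) (hB : ∀ i, 0 ≤ B i)
    (hρs : ∀ j, 0 < ρs j) (hε : 0 < ε)
    (hfit : FitsBids ε (Sum.elim v (participantSamples ρ ρs))) {A : Allocation N M}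
    (hA : IsSingleSampleOutcome G v ρ ρs B ε A) :
    (∀ e, e ∉ G.E → A.w e = 0) ∧ (∀ j, 0 ≤ supply A.w j) ∧
    (∀ j, supply A.w j ≤ G.f j (G.sellerEdges j)) ∧
    (∀ j, j ∉ participants ρ ρs → supply A.w j = 0) ∧
    ∀ x ∈ G.polymatroid, ∑ i, min (v i * ∑ j ∈ participants ρ ρs, x (i, j)) (B i) +
        ∑ j ∈ participants ρ ρs, ρs j * (G.f j (G.sellerEdges j) - supply x j) ≤
      2 * (∑ i, min (v i * amount A.w i) (B i) +
        ∑ j ∈ participants ρ ρs, ρs j * (G.f j (G.sellerEdges j) - supply A.w j)) := by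
  obtain ⟨A', hA', rfl⟩ := hA
  obtain ⟨hmem, hhalf⟩ := hA'.half_optimal
    (by rintro (i | j) <;> [exact hv i; exact hρs j]) hε hB hfit
  set w : N × M → ℝ := fun e => if h : e.2 ∈ participants ρ ρs then A'.w (e.1, ⟨e.2, h⟩) else 0 with hw
  have hin : ∀ i (j : {j // j ∈ participants ρ ρs}), w (i, (j : M)) = A'.w (i, j) := by
    intro i j
    simp [hw]
  have hout : ∀ i j, j ∉ participants ρ ρs → w (i, j) = 0 := by
    intro i j hj
    simp [hw, hj]
  have hsup : ∀ j : {j // j ∈ participants ρ ρs}, supply w (j : M) = supply A'.w j := fun j =>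
    Finset.sum_congr rfl fun i _ => hin i j
  have hsup0 : ∀ j, j ∉ participants ρ ρs → supply w j = 0 := fun j hj =>
    Finset.sum_eq_zero fun i _ => hout i j hj
  have hamt : ∀ i, amount w i = amount A'.w i := by
    intro i
    have h1 : amount w i = ∑ j ∈ participants ρ ρs, w (i, j) := by
      refine (Finset.sum_subset (Finset.subset_univ _) fun j _ hj => hout i j hj).symm
    rw [h1, ← Finset.sum_coe_sort (participants ρ ρs) (fun j => w (i, j))]
    exact Finset.sum_congr rfl fun j _ => hin i j
  have hw0 : ∀ e, 0 ≤ w e := by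
    intro e
    simp only [hw]
    split_ifs
    · exact hmem.1 _
    · exact le_rfl
  have hF : ∀ j : {j // j ∈ participants ρ ρs},
      @Market.f N {j // j ∈ participants ρ ρs} _ LinearOrder.toDecidableEq
        (G.restrict (participants ρ ρs)) j
        (@Market.sellerEdges N {j // j ∈ participants ρ ρs} _ LinearOrder.toDecidableEq
          (G.restrict (participants ρ ρs)) j) = G.f j (G.sellerEdges j) :=
    fun j => Market.restrict_f_sellerEdges j
  have hf0 : ∀ j, 0 ≤ G.f j (G.sellerEdges j) := fun j =>
    G.f_empty j ▸ G.f_mono j _ _ (Finset.empty_subset _) (subset_refl _)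
  refine ⟨fun e he => ?_, fun j => Finset.sum_nonneg fun i _ => hw0 _, fun j => ?_, hsup0,
    fun x hx => ?_⟩
  · simp only [hw]
    split_ifs with h
    · exact hmem.2.1 _ fun hE => he (Market.mem_restrict.1 hE)
    · rfl
  · by_cases hj : j ∈ participants ρ ρs
    · have := Market.supply_le hmem ⟨j, hj⟩
      rw [hF] at this
      rw [hsup ⟨j, hj⟩]; exact this
    · rw [hsup0 j hj]; exact hf0 j
  · have h := hhalf _ (Market.restrict_mem_polymatroid hx)
    simp only [hF, ← hsup, ← hamt] at h
    have hx1 : ∀ i, amount (fun e : N × {j // j ∈ participants ρ ρs} => x (e.1, (e.2 : M))) i =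
        ∑ j ∈ participants ρ ρs, x (i, j) := fun i => Finset.sum_coe_sort (participants ρ ρs) (fun j => x (i, j))
    have hsum : ∀ u : N × M → ℝ, ∑ j : {j // j ∈ participants ρ ρs}, participantSamples ρ ρs j *
        (G.f j (G.sellerEdges j) - supply u (j : M)) =
        ∑ j ∈ participants ρ ρs, ρs j * (G.f j (G.sellerEdges j) - supply u j) := fun u =>
      Finset.sum_coe_sort (participants ρ ρs) (fun j => ρs j * (G.f j (G.sellerEdges j) - supply u j))
    have h2 := hsum x
    have h3 := hsum w
    have h4 : ∀ j : {j // j ∈ participants ρ ρs},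
        supply (fun e : N × {j // j ∈ participants ρ ρs} => x (e.1, (e.2 : M))) j = supply x j :=
      fun _ => rfl
    simp only [hx1, h4] at h
    rw [← h2, ← h3]
    exact h

lemma mem_participants {M : Type} [Fintype M] {ρ ρs : M → ℝ} {j : M} : j ∈ participants ρ ρs ↔ ρ j ≤ ρs j := by
  simp [participants]

/-- Two runs with exchanged roles of values and samples together have at least half of the optimal
liquid welfare at the larger values. -/
theorem liquidWelfare_le_two_mul_add (hv : ∀ i, 0 < v i) (hB : ∀ i, 0 ≤ B i) {ρa ρb ρ : M → ℝ}
    (hρa : ∀ j, 0 < ρa j) (hρb : ∀ j, 0 < ρb j) (hε : 0 < ε)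
    (hab : FitsBids ε (Sum.elim v (participantSamples ρa ρb)))
    (hba : FitsBids ε (Sum.elim v (participantSamples ρb ρa))) {Aab Aba A : Allocation N M}
    (hAab : IsSingleSampleOutcome G v ρa ρb B ε Aab)
    (hAba : IsSingleSampleOutcome G v ρb ρa B ε Aba)
    (hρ : ∀ j, ρ j ≤ max (ρa j) (ρb j)) (hA : A.w ∈ G.polymatroid) :
    G.liquidWelfare v B ρ A ≤
      2 * (G.liquidWelfare v B ρa Aab + G.liquidWelfare v B ρb Aba) := by
  obtain ⟨hE₁, hn₁, hle₁, hout₁, hhalf₁⟩ := hAab.half_optimal hv hB hρb hε hab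
  obtain ⟨hE₂, hn₂, hle₂, hout₂, hhalf₂⟩ := hAba.half_optimal hv hB hρa hε hba
  rw [G.liquidWelfare_eq v B ρ hA.2.1, G.liquidWelfare_eq v B ρa hE₁,
    G.liquidWelfare_eq v B ρb hE₂]
  set P := participants ρa ρb with hP
  set Q := participants ρb ρa with hQ
  have hPm : ∀ j, j ∈ P ↔ ρa j ≤ ρb j := fun j => mem_participants
  have hQm : ∀ j, j ∈ Q ↔ ρb j ≤ ρa j := fun j => mem_participants
  have h1 := hhalf₁ A.w hA
  have h2 := hhalf₂ A.w hA
  set f : M → ℝ := fun j => G.f j (G.sellerEdges j) with hf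
  -- `P` and `Q` cover all sellers, and truncation at a nonnegative budget is subadditive.
  have hbuyers : ∑ i, min (v i * amount A.w i) (B i) ≤
      ∑ i, min (v i * ∑ j ∈ P, A.w (i, j)) (B i) + ∑ i, min (v i * ∑ j ∈ Q, A.w (i, j)) (B i) := by
    rw [← Finset.sum_add_distrib]
    refine Finset.sum_le_sum fun i _ => ?_
    have ha : amount A.w i ≤ ∑ j ∈ P, A.w (i, j) + ∑ j ∈ Q, A.w (i, j) := by
      rw [← Finset.sum_union_inter]
      have hu : P ∪ Q = Finset.univ := Finset.eq_univ_of_forall fun j => by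
        rw [Finset.mem_union, hPm, hQm]; exact le_total _ _
      rw [hu]
      exact le_add_of_nonneg_right (Finset.sum_nonneg fun j _ => hA.1 _)
    have hp0 : 0 ≤ v i * ∑ j ∈ P, A.w (i, j) :=
      mul_nonneg (hv i).le (Finset.sum_nonneg fun j _ => hA.1 _)
    have hq0 : 0 ≤ v i * ∑ j ∈ Q, A.w (i, j) :=
      mul_nonneg (hv i).le (Finset.sum_nonneg fun j _ => hA.1 _)
    have hm := mul_le_mul_of_nonneg_left ha (hv i).le
    rw [mul_add] at hm
    rcases min_cases (v i * ∑ j ∈ P, A.w (i, j)) (B i) with ⟨e1, -⟩ | ⟨e1, -⟩ <;>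
    rcases min_cases (v i * ∑ j ∈ Q, A.w (i, j)) (B i) with ⟨e2, -⟩ | ⟨e2, -⟩ <;>
    rw [e1, e2]
    · exact (min_le_left _ _).trans hm
    · exact (min_le_right _ _).trans (by linarith)
    · exact (min_le_right _ _).trans (by linarith)
    · exact (min_le_right _ _).trans (by linarith [hB i])
  have hite : ∀ (R : Finset M) (g : M → ℝ), ∑ j ∈ R, g j = ∑ j, if j ∈ R then g j else 0 := by
    intro R g
    rw [← Finset.sum_filter, Finset.filter_mem_eq_inter, Finset.univ_inter]
  -- Each seller takes part in a run whose sample is the larger of her two values.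
  have hsellers : ∑ j, ρ j * (f j - supply A.w j) ≤
      ∑ j ∈ P, ρb j * (f j - supply A.w j) + ∑ j ∈ Q, ρa j * (f j - supply A.w j) := by
    rw [hite P, hite Q, ← Finset.sum_add_distrib]
    refine Finset.sum_le_sum fun j _ => ?_
    have h0 : 0 ≤ f j - supply A.w j := sub_nonneg.2 (Market.supply_le hA j)
    have hmax := mul_le_mul_of_nonneg_right (hρ j) h0
    have ha := mul_nonneg (hρa j).le h0
    have hb := mul_nonneg (hρb j).le h0
    simp only [hPm, hQm]
    rcases le_total (ρa j) (ρb j) with hab | hab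
    · rw [max_eq_right hab] at hmax
      rw [if_pos hab]
      split_ifs <;> linarith
    · rw [max_eq_left hab] at hmax
      rw [if_pos hab]
      split_ifs <;> linarith
  -- If `ρa j < ρb j`, the first run overstates her kept goods by using `ρb j`. In the second run
  -- she sells nothing, and her whole supply at `ρb j` covers the difference. For equal values both
  -- sides agree.
  have hkeep : ∑ j ∈ P, ρb j * (f j - supply Aab.w j) + ∑ j ∈ Q, ρa j * (f j - supply Aba.w j) ≤
      ∑ j, ρa j * (f j - supply Aab.w j) + ∑ j, ρb j * (f j - supply Aba.w j) := by
    rw [hite P, hite Q, ← Finset.sum_add_distrib, ← Finset.sum_add_distrib]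
    refine Finset.sum_le_sum fun j _ => ?_
    have hs1 : 0 ≤ f j - supply Aab.w j := sub_nonneg.2 (hle₁ j)
    have hs2 : 0 ≤ f j - supply Aba.w j := sub_nonneg.2 (hle₂ j)
    simp only [hPm, hQm]
    rcases lt_trichotomy (ρa j) (ρb j) with hlt | heq | hlt
    · rw [if_pos hlt.le, if_neg (not_le.2 hlt), hout₂ j ((hQm j).not.2 (not_le.2 hlt))]
      nlinarith [mul_nonneg (hρa j).le hs1, mul_nonneg (hρb j).le (hn₁ j)]
    · rw [if_pos heq.le, if_pos heq.ge, heq]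
    · rw [if_neg (not_le.2 hlt), if_pos hlt.le, hout₁ j ((hPm j).not.2 (not_le.2 hlt))]
      nlinarith [mul_nonneg (hρb j).le hs2, mul_nonneg (hρa j).le (hn₂ j)]
  simp only [hf] at hsellers hkeep
  linarith

end singleSample

end Auction

lemma Market.optLiquidWelfare_le {N M : Type} [DecidableEq N] [DecidableEq M] [Fintype N]
    [Fintype M] (G : Market N M) {v B : N → ℝ} {ρ : M → ℝ} {C : ℝ} (hB : ∀ i, 0 ≤ B i)
    (h : ∀ A : Allocation N M, A.w ∈ G.polymatroid → G.liquidWelfare v B ρ A ≤ C) :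
    G.optLiquidWelfare v B ρ ≤ C := by
  refine csSup_le ⟨_, ⟨0, 0, 0⟩, ⟨?_, fun i => ⟨le_rfl, hB i⟩, fun _ => le_rfl⟩, rfl⟩ ?_
  · rw [G.mem_polymatroid_iff]
    refine ⟨fun _ => le_rfl, fun F => ?_⟩
    have := G.rank_isPolymatroidRank
    simpa [this.empty] using this.mono ∅ F (Finset.empty_subset F)
  · rintro t ⟨A, hA, rfl⟩
    exact h A hA.1

end

theorem theorem4p5 (n m : ℕ) (G : Market (Fin n) (Fin m)) (v B : Fin n → ℝ)
    (ρa ρb : Fin m → ℝ) (ε : ℝ)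
    (hv : ∀ i, 0 < v i) (hB : ∀ i, 0 ≤ B i) (hρa : ∀ j, 0 < ρa j) (hρb : ∀ j, 0 < ρb j)
    (hε : 0 < ε)
    (hab : Auction.FitsBids ε (Sum.elim v (Auction.participantSamples ρa ρb)))
    (hba : Auction.FitsBids ε (Sum.elim v (Auction.participantSamples ρb ρa))) :
    (∃ A, Auction.IsSingleSampleOutcome G v ρa ρb B ε A) ∧
    (∃ A, Auction.IsSingleSampleOutcome G v ρb ρa B ε A) ∧
    ∀ Aab Aba : Allocation (Fin n) (Fin m),
      Auction.IsSingleSampleOutcome G v ρa ρb B ε Aab →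
      Auction.IsSingleSampleOutcome G v ρb ρa B ε Aba →
      G.liquidWelfare v B ρa Aab + G.liquidWelfare v B ρb Aba ≥
        (1 / 4 : ℝ) * (G.optLiquidWelfare v B ρa + G.optLiquidWelfare v B ρb) := by
  refine ⟨Auction.exists_isSingleSampleOutcome hv hB hρb hε hab,
    Auction.exists_isSingleSampleOutcome hv hB hρa hε hba, fun Aab Aba hAab hAba => ?_⟩
  -- Both optima obey the same bound, since both value vectors lie below the maximum; adding gives
  -- the factor 4.
  have h1 := G.optLiquidWelfare_le (v := v) hB fun A hA =>
    Auction.liquidWelfare_le_two_mul_add hv hB hρa hρb hε hab hba hAab hAba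
      (fun j => le_max_left (ρa j) (ρb j)) hA
  have h2 := G.optLiquidWelfare_le (v := v) hB fun A hA =>
    Auction.liquidWelfare_le_two_mul_add hv hB hρa hρb hε hab hba hAab hAba
      (fun j => le_max_right (ρa j) (ρb j)) hA
  linarith
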